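/- Let $N\ge 2$, let $U\subset\mathbb R^N$ be open with coordinates $x=(x^1,\dots,x^N)$, and write $\partial_i=\partial/\partial x^i$. Let $H_i^{-2}$, $\rho^{(\ell)}_i$, $v_i$ ($1\le i,\ell\le N$) be smooth real functions on $U$, where the $H_i^{-2}$ vanish nowhere (components of an orthogonal Riemannian or pseudo-Riemannian metric) and $\rho^{(1)}_i=1$. Put $$\mathcal L^\ell(x,p)=\sum_{i=1}^N\rho^{(\ell)}_iH_i^{-2}\,(p_i^2+v_i(x)),\qquad \mathcal H=\mathcal L^1,\qquad T^{\ell i}=\rho^{(\ell)}_iH_i^{-2}.$$ For functions $F,G$ on $U\times\mathbb R^N$ let $\{F,G\}=\sum_i(\partial_{x^i}G\,\partial_{p_i}F-\partial_{x^i}F\,\partial_{p_i}G)$, and say that $\{F,G\}=0$ modulo $\mathcal L^N=0$ if at each $x\in U$ it is $\mathcal L^N$ times a polynomial in $p$. An open box is a product of $N$ open intervals, possibly unbounded. Assume that at every $x\in U$ the functions $\mathcal L^1(x,\cdot),\dots,\mathcal L^N(x,\cdot)$ are linearly independent, and that $\{\mathcal H,\mathcal L^k\}=0$ modulo $\mathcal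 L^N=0$ for $k=1,\dots,N$. Then: (1) $\partial_jv_i=0$ on $U$ for $j\ne i$; and for all $\ell,i,\alpha,m$, at every $x\in U$ with $\rho^{(N)}_m(x)\ne0$, $$\partial_i\rho^{(\ell)}_\alpha+(\rho^{(\ell)}_\alpha-\rho^{(\ell)}_i)\frac{\partial_iH_\alpha^{-2}}{H_\alpha^{-2}}=\frac{\rho^{(N)}_\alpha}{\rho^{(N)}_m}\left(\partial_i\rho^{(\ell)}_m+(\rho^{(\ell)}_m-\rho^{(\ell)}_i)\frac{\partial_iH_m^{-2}}{H_m^{-2}}\right).$$ (2) On every open box $Q\subset U$ the inverse $S=T^{-1}$ of the matrix $(T^{\ell i})$ is a generalized Stäckel matrix: it is smooth and nonsingular, and for $\xi\le N-1$ the entry $S_{i\xi}$ is a function of $x^i$ only; its last column consists of functions of all $N$ variables, on which no condition is imposed. (3) The Hamilton–Jacobi equation $\mathcal H(x,\partial u)=E$ has maximal nonregular separated solutions on $\mathcal L^N=0$, depending on $N-1$ parameters $c=(c_1,\dots,c_{N-1})$ with $E=c_1$, in the following sense. (a) On every open box $Q\subset U$ there are complex-valued functions $u(\cdot,c)$, one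 for every $c\in\mathbb R^{N-1}$, which are $C^1$ and additively separated, $u=\sum_i\varphi_i(x^i,c)$, with $\partial_iu$ continuous in $(x,c)$, and which satisfy $\mathcal L^N(x,\partial u)=0$ and $\mathcal L^\xi(x,\partial u)=c_\xi$ for $1\le\xi\le N-1$. (b) Let $\mathbb K=\mathbb R$ or $\mathbb C$. For all $x_0\in U$ and $p_0\in\mathbb K^N$ with all components nonzero and $\mathcal L^N(x_0,p_0)=0$ there are a neighbourhood $V\subset U$ of $x_0$, an open set $\Lambda\subset\mathbb K^{N-1}$, some $c_0\in\Lambda$ and a smooth function $u\colon V\times\Lambda\to\mathbb K$ (holomorphic in $c$ if $\mathbb K=\mathbb C$), such that every $u(\cdot,c)$ is additively separated and satisfies the equations of (a) on $V$, the matrix $(\partial_{c_\xi}\partial_iu)$ has rank $N-1$ on $V\times\Lambda$, and $\partial u(x_0,c_0)=p_0$. (4) $\{\mathcal L^\ell,\mathcal L^k\}=0$ modulo $\mathcal L^N=0$ for all $\ell,k$. -/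

import Mathlib

open scoped ContDiff

noncomputable section

namespace NonregularSeparation

/-- The partial derivative `∂f/∂xⁱ` at `x` of a function on `ℝᴺ`. -/
def pd {N : ℕ} {E : Type*} [NormedAddCommGroup E] [NormedSpace ℝ E]
    (i : Fin N) (f : (Fin N → ℝ) → E) (x : Fin N → ℝ) : E :=
  fderiv ℝ f x (Pi.single i 1)

/-- The Poisson bracket
`{F, G} = ∑ᵢ (∂G/∂xⁱ ∂F/∂pᵢ - ∂F/∂xⁱ ∂G/∂pᵢ)` of two functions of `(x, p)`. -/
def poisson {N : ℕ} (F G : (Fin N → ℝ) → (Fin N → ℝ) → ℝ) (x p : Fin N → ℝ) : ℝ :=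
  ∑ i, (pd i (fun y => G y p) x * pd i (F x) p - pd i (fun y => F y p) x * pd i (G x) p)

/-- `{F, G}` vanishes modulo `S = 0` over `U`: at each `x ∈ U` it is the product of `S` and
a polynomial in the momenta, `{F, G} = B S`. -/
def InvolutiveModulo {N : ℕ} (U : Set (Fin N → ℝ))
    (S F G : (Fin N → ℝ) → (Fin N → ℝ) → ℝ) : Prop :=
  ∀ x ∈ U, ∃ B : MvPolynomial (Fin N) ℝ, ∀ p : Fin N → ℝ,
    poisson F G x p = MvPolynomial.eval p B * S x p

/-- The matrix `T^{ℓ i} = ρ^{(ℓ)}_i H_i^{-2}`; here `g i` is the function `H_i^{-2}`. -/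
def coeffMatrix {N : ℕ} (g : Fin N → (Fin N → ℝ) → ℝ) (ρ : Fin N → Fin N → (Fin N → ℝ) → ℝ)
    (x : Fin N → ℝ) : Matrix (Fin N) (Fin N) ℝ :=
  Matrix.of fun ℓ i => ρ ℓ i x * g i x

/-- The quadratic function `𝓛^ℓ = ∑ᵢ ρ^{(ℓ)}_i H_i^{-2} (pᵢ² + vᵢ)`, for momenta in `𝕜`
(the coefficients are real). -/
def quadFun (𝕜 : Type*) [RCLike 𝕜] {N : ℕ} (g : Fin N → (Fin N → ℝ) → ℝ)
    (ρ : Fin N → Fin N → (Fin N → ℝ) → ℝ) (v : Fin N → (Fin N → ℝ) → ℝ)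
    (ℓ : Fin N) (x : Fin N → ℝ) (p : Fin N → 𝕜) : 𝕜 :=
  ∑ i, (ρ ℓ i x * g i x) • (p i ^ 2 + algebraMap ℝ 𝕜 (v i x))

/-- Open boxes: products of (possibly empty or unbounded) open intervals. -/
def IsOpenBox {N : ℕ} (Q : Set (Fin N → ℝ)) : Prop :=
  ∃ I : Fin N → Set ℝ, (∀ i, IsOpen (I i) ∧ (I i).OrdConnected) ∧ Q = Set.univ.pi I

/-- Generalized Stäckel matrices on `Q`: smooth and nonsingular; in every column but the last
one, the entries of row `i` are functions of `xⁱ` only.  There is no condition on the entries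
of the last column. -/
structure IsGeneralizedStackel {n : ℕ} (Q : Set (Fin (n + 2) → ℝ))
    (S : (Fin (n + 2) → ℝ) → Matrix (Fin (n + 2)) (Fin (n + 2)) ℝ) : Prop where
  smooth : ∀ i j, ContDiffOn ℝ ∞ (fun x => S x i j) Q
  nonsingular : ∀ x ∈ Q, (S x).det ≠ 0
  separated : ∀ (i : Fin (n + 2)) (ξ : Fin (n + 1)),
    ∃ s : ℝ → ℝ, ∀ x ∈ Q, S x i ξ.castSucc = s (x i)

/-- `w` is a `C¹` additively separated solution on `Q` of the Hamilton-Jacobi equation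
`𝓛¹(x, ∂w) = c₁` with side condition `𝓛ᴺ(x, ∂w) = 0`, on which each of the remaining functions
`𝓛^ξ`, `2 ≤ ξ ≤ N - 1`, is equal to the constant `c_ξ`. -/
structure IsSeparatedSolution (𝕜 : Type*) [RCLike 𝕜] {n : ℕ}
    (L : Fin (n + 2) → (Fin (n + 2) → ℝ) → (Fin (n + 2) → 𝕜) → 𝕜)
    (Q : Set (Fin (n + 2) → ℝ)) (c : Fin (n + 1) → 𝕜) (w : (Fin (n + 2) → ℝ) → 𝕜) : Prop where
  smooth : ContDiffOn ℝ 1 w Q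
  separated : ∃ φ : Fin (n + 2) → ℝ → 𝕜, ∀ x ∈ Q, w x = ∑ i, φ i (x i)
  hamiltonJacobi : ∀ x ∈ Q, L 0 x (fun i => pd i w x) = c 0
  sideCondition : ∀ x ∈ Q, L (Fin.last (n + 1)) x (fun i => pd i w x) = 0
  constants : ∀ x ∈ Q, ∀ ξ : Fin (n + 1), L ξ.castSucc x (fun i => pd i w x) = c ξ

/-- On `V × Λ`, `u(x, c)` is a smooth family of separated solutions that depends essentially on
the `N - 1` parameters `c`, i.e. the matrix `(∂²u / ∂c_ξ ∂xⁱ)` has rank `N - 1`.  (When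
`𝕜 = ℂ` the dependence on `c` is holomorphic.) -/
structure IsSeparatedFamily (𝕜 : Type*) [RCLike 𝕜] {n : ℕ}
    (L : Fin (n + 2) → (Fin (n + 2) → ℝ) → (Fin (n + 2) → 𝕜) → 𝕜)
    (V : Set (Fin (n + 2) → ℝ)) (Λ : Set (Fin (n + 1) → 𝕜))
    (u : (Fin (n + 2) → ℝ) → (Fin (n + 1) → 𝕜) → 𝕜) : Prop where
  smooth : ContDiffOn ℝ ∞ (fun z : (Fin (n + 2) → ℝ) × (Fin (n + 1) → 𝕜) => u z.1 z.2) (V ×ˢ Λ)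
  differentiable : ∀ x ∈ V, DifferentiableOn 𝕜 (u x) Λ
  solution : ∀ c ∈ Λ, IsSeparatedSolution 𝕜 L V c (fun x => u x c)
  rank : ∀ x ∈ V, ∀ c ∈ Λ, LinearIndependent 𝕜 (fun (ξ : Fin (n + 1)) (i : Fin (n + 2)) =>
    fderiv 𝕜 (fun b => pd i (fun y => u y b) x) c (Pi.single ξ 1))

/-- Through every point `(x₀, p₀)` of `𝓛ᴺ = 0` over `U` whose momenta are all nonzero there
passes a smooth separated family with `N - 1` essential parameters. -/
def HasSeparatedFamilies (𝕜 : Type*) [RCLike 𝕜] {n : ℕ}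
    (L : Fin (n + 2) → (Fin (n + 2) → ℝ) → (Fin (n + 2) → 𝕜) → 𝕜)
    (U : Set (Fin (n + 2) → ℝ)) : Prop :=
  ∀ x₀ ∈ U, ∀ p₀ : Fin (n + 2) → 𝕜, (∀ i, p₀ i ≠ 0) → L (Fin.last (n + 1)) x₀ p₀ = 0 →
    ∃ (V : Set (Fin (n + 2) → ℝ)) (Λ : Set (Fin (n + 1) → 𝕜))
      (u : (Fin (n + 2) → ℝ) → (Fin (n + 1) → 𝕜) → 𝕜) (c₀ : Fin (n + 1) → 𝕜),
      IsOpen V ∧ x₀ ∈ V ∧ V ⊆ U ∧ IsOpen Λ ∧ c₀ ∈ Λ ∧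
      IsSeparatedFamily 𝕜 L V Λ u ∧ ∀ i, pd i (fun x => u x c₀) x₀ = p₀ i

end NonregularSeparation

end

noncomputable section

namespace NonregularSeparation

/-! ### Brackets of even quadratic functions. -/

section

/-! Let `T` be the coefficient matrix and `l` the index of the side condition. The bracket of two of
the quadratic functions is `∑ᵢ pᵢ fᵢ(p)` with every `fᵢ` even in each momentum. If it is a multiple
of `𝓛^l`, the factor is affine, and flipping the sign of one momentum shows that each `fᵢ` is a
constant multiple of `𝓛^l` (`cubic_factor`). For brackets with the Hamiltonian this says that `∂ᵢT`
is a sum of two outer products, `(ρ^{(k)}_i)ₖ` with `(∂ᵢgⱼ)ⱼ` and `(b i k)ₖ` with row `l` of `T`,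
and that `∂ᵢvⱼ = 0` for `j ≠ i` (`exists_structureEquations_and_pd_potential`).

These structure equations carry the rest. Eliminating `b` gives the generalized Eisenhart equations.
In a general bracket the first outer product cancels by antisymmetry and the second contributes a
multiple of `𝓛^l`. For `S = T⁻¹`, row `l` of `T` annihilates every column of `S` but the `l`-th, and
`(ρ^{(k)}_i)ₖ` is proportional to column `i` of `T`; so `∂ᵢ` of such a column of `S` is a multiple
of the `i`-th unit vector (`StructureEquations.pd_inv_eq_zero`).

Finally, `𝓛 = (c, 0)` is equivalent to `pᵢ² + vᵢ = ∑_ξ S_{iξ} c_ξ`, the zero suppressing the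
unrestricted last column. On a box `pᵢ²` is then a function of `xⁱ` and `c`, and integrating square
roots gives `u`. -/

lemma exists_affine_eval {σ : Type*} [Fintype σ] [DecidableEq σ] (P : MvPolynomial σ ℝ)
    (hP : P.totalDegree ≤ 1) :
    ∃ (b₀ : ℝ) (b : σ → ℝ), ∀ x, MvPolynomial.eval x P = b₀ + ∑ i, b i * x i := by
  have key : ∀ d ∈ P.support, ∃ (b₀ : ℝ) (b : σ → ℝ), ∀ x : σ → ℝ,
      MvPolynomial.coeff d P * ∏ i, x i ^ d i = b₀ + ∑ i, b i * x i := by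
    intro d hd
    have h1 : d.degree ≤ 1 := (MvPolynomial.le_totalDegree hd).trans hP
    by_cases h0 : d = 0
    · exact ⟨MvPolynomial.coeff d P, 0, fun x => by simp [h0]⟩
    · obtain ⟨i, hi⟩ := Finsupp.ne_iff.1 h0
      have hle : Finsupp.single i 1 ≤ d := by
        rw [Finsupp.single_le_iff]
        simpa [Nat.one_le_iff_ne_zero] using hi
      have hd' : d - Finsupp.single i 1 + Finsupp.single i 1 = d := tsub_add_cancel_of_le hle
      have h2 : (d - Finsupp.single i 1).degree = 0 := by
        have := congrArg Finsupp.degree hd'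
        rw [map_add, Finsupp.degree_single] at this
        omega
      rw [Finsupp.degree_eq_zero_iff] at h2
      rw [h2, zero_add] at hd'
      refine ⟨0, Pi.single i (MvPolynomial.coeff d P), fun x => ?_⟩
      rw [← hd']
      simp [Finsupp.single_apply, Pi.single_apply, pow_ite]
  choose! b₀ b hb using key
  refine ⟨∑ d ∈ P.support, b₀ d, fun i => ∑ d ∈ P.support, b d i, fun x => ?_⟩
  rw [MvPolynomial.eval_eq', Finset.sum_congr rfl fun d hd => hb d hd x, Finset.sum_add_distrib,
    Finset.sum_comm]
  simp_rw [Finset.sum_mul]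

/-- A cubic `∑ᵢ pᵢ fᵢ(p)`, with even quadratic `fᵢ`, that is a multiple of an even quadratic
polynomial: every `fᵢ` is a constant multiple of it. -/
lemma cubic_factor {N : ℕ} (A : Fin N → Fin N → ℝ) (w v t : Fin N → ℝ) (ht : t ≠ 0)
    (B : MvPolynomial (Fin N) ℝ)
    (h : ∀ p : Fin N → ℝ, ∑ i, p i * (∑ j, A i j * (p j ^ 2 + v j) + w i) =
      MvPolynomial.eval p B * ∑ j, t j * (p j ^ 2 + v j)) (i : Fin N) :
    w i = 0 ∧ ∃ b, ∀ j, A i j = b * t j := by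
  classical
  obtain ⟨j₀, hj₀⟩ := Function.ne_iff.1 ht
  have hj₀ : t j₀ ≠ 0 := hj₀
  let S : MvPolynomial (Fin N) ℝ :=
    ∑ j, MvPolynomial.C (t j) * (MvPolynomial.X j ^ 2 + MvPolynomial.C (v j))
  let P : MvPolynomial (Fin N) ℝ := ∑ i, MvPolynomial.X i *
    (∑ j, MvPolynomial.C (A i j) * (MvPolynomial.X j ^ 2 + MvPolynomial.C (v j)) +
      MvPolynomial.C (w i))
  have hPS : P = B * S := MvPolynomial.funext fun p => by simpa [P, S] using h p
  -- This square makes `S` of degree at least two. Degrees add over a domain and `P` has degree at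
  -- most three, so `B` is affine.
  have hc : MvPolynomial.coeff (Finsupp.single j₀ 2) S = t j₀ := by
    simp only [S, MvPolynomial.coeff_sum, MvPolynomial.coeff_C_mul, MvPolynomial.coeff_add,
      MvPolynomial.coeff_X_pow, MvPolynomial.coeff_C]
    rw [Finset.sum_eq_single j₀]
    · simp [eq_comm (a := (0 : Fin N →₀ ℕ))]
    · intro j _ hj
      simp [hj, Finsupp.single_left_inj, eq_comm (a := (0 : Fin N →₀ ℕ))]
    · simp
  have hS2 : 2 ≤ S.totalDegree := by
    have := MvPolynomial.le_totalDegree (p := S) (s := Finsupp.single j₀ 2)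
      (by rw [MvPolynomial.mem_support_iff, hc]; exact hj₀)
    simpa using this
  have hS0 : S ≠ 0 := by
    intro h0
    rw [h0] at hc
    exact hj₀ (by simpa using hc.symm)
  have hq : ∀ (a b : ℝ) (j : Fin N), (MvPolynomial.C a * (MvPolynomial.X j ^ 2 +
      MvPolynomial.C b) : MvPolynomial (Fin N) ℝ).totalDegree ≤ 2 := by
    intro a b j
    refine (MvPolynomial.totalDegree_mul _ _).trans ?_
    rw [MvPolynomial.totalDegree_C, zero_add]
    refine (MvPolynomial.totalDegree_add _ _).trans ?_
    simp [MvPolynomial.totalDegree_X_pow]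
  have hP3 : P.totalDegree ≤ 3 := by
    refine MvPolynomial.totalDegree_finsetSum_le fun i _ => ?_
    refine (MvPolynomial.totalDegree_mul _ _).trans ?_
    rw [MvPolynomial.totalDegree_X]
    have : (∑ j, MvPolynomial.C (A i j) * (MvPolynomial.X j ^ 2 + MvPolynomial.C (v j)) +
        MvPolynomial.C (w i) : MvPolynomial (Fin N) ℝ).totalDegree ≤ 2 := by
      refine (MvPolynomial.totalDegree_add _ _).trans (max_le ?_ (by simp))
      exact MvPolynomial.totalDegree_finsetSum_le fun j _ => hq _ _ _
    omega
  have hB1 : B.totalDegree ≤ 1 := by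
    by_cases hB : B = 0
    · simp [hB]
    · have := MvPolynomial.totalDegree_mul_of_isDomain hB hS0
      rw [← hPS] at this
      omega
  obtain ⟨b₀, b, hb⟩ := exists_affine_eval B hB1
  let f : (Fin N → ℝ) → ℝ := fun p => ∑ j, A i j * (p j ^ 2 + v j) + w i
  let s : (Fin N → ℝ) → ℝ := fun p => ∑ j, t j * (p j ^ 2 + v j)
  -- the part that is odd in the `i`-th momentum
  have hodd : ∀ p : Fin N → ℝ, p i ≠ 0 → f p = b i * s p := by
    intro p hp
    -- All squares are unchanged, so subtracting the identities at `p` and `p'` leaves `2 pᵢ (f p -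
    -- bᵢ s p) = 0`; the constant `b₀` drops out.
    let p' := Function.update p i (-p i)
    have hsq : ∀ j, p' j ^ 2 = p j ^ 2 := by
      intro j
      by_cases hj : j = i
      · subst hj; simp [p']
      · simp [p', hj]
    have h1 := h p
    have h2 := h p'
    rw [hb] at h1 h2
    simp only [hsq] at h2
    have e1 : ∀ F : Fin N → ℝ, ∑ k, p' k * F k = ∑ k, p k * F k - 2 * (p i * F i) := by
      intro F
      rw [← Finset.add_sum_erase _ _ (Finset.mem_univ i),
        ← Finset.add_sum_erase (a := i) _ (fun k => p k * F k) (Finset.mem_univ i)]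
      have : ∑ k ∈ Finset.univ.erase i, p' k * F k = ∑ k ∈ Finset.univ.erase i, p k * F k :=
        Finset.sum_congr rfl fun k hk => by simp [p', Finset.ne_of_mem_erase hk]
      rw [this]
      simp [p']
      ring
    have e2 : ∑ k, b k * p' k = ∑ k, b k * p k - 2 * (p i * b i) := by
      have := e1 b
      simpa only [mul_comm] using this
    rw [e1, e2] at h2
    have : p i * (f p - b i * s p) = 0 := by
      simp only [f, s]
      linear_combination (h1 - h2) / 2
    rcases mul_eq_zero.1 this with h0 | h0
    · exact absurd h0 hp
    · linarith
  have hA : ∀ j, A i j = b i * t j := by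
    intro j
    -- Raising one momentum from 1 to 2 isolates the coefficient of its square, with factor `2² - 1²
    -- = 3`.
    have h1 := hodd (fun _ => 1) one_ne_zero
    have h2 := hodd (Function.update (fun _ => 1) j 2) (by
      by_cases hj : i = j
      · subst hj; simp
      · simp [hj])
    have e : ∀ (F : Fin N → ℝ), ∑ k, F k * (Function.update (fun _ => (1 : ℝ)) j 2 k ^ 2 + v k) =
        ∑ k, F k * ((1 : ℝ) ^ 2 + v k) + 3 * F j := by
      intro F
      rw [← Finset.add_sum_erase _ _ (Finset.mem_univ j),
        ← Finset.add_sum_erase (a := j) _ (fun k => F k * ((1 : ℝ) ^ 2 + v k)) (Finset.mem_univ j)]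
      have : ∑ k ∈ Finset.univ.erase j,
            F k * (Function.update (fun _ => (1 : ℝ)) j 2 k ^ 2 + v k) =
          ∑ k ∈ Finset.univ.erase j, F k * ((1 : ℝ) ^ 2 + v k) :=
        Finset.sum_congr rfl fun k hk => by simp [Finset.ne_of_mem_erase hk]
      rw [this]
      simp
      ring
    simp only [f, s, e] at h1 h2
    linear_combination (h2 - h1) / 3
  refine ⟨?_, b i, hA⟩
  have h1 := hodd (fun _ => 1) one_ne_zero
  simp only [f, s, hA, Finset.mul_sum, mul_assoc] at h1
  linarith

variable {N : ℕ} {g : Fin N → (Fin N → ℝ) → ℝ}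
  {ρ : Fin N → Fin N → (Fin N → ℝ) → ℝ} {v : Fin N → (Fin N → ℝ) → ℝ}

lemma pd_mul {f h : (Fin N → ℝ) → ℝ} {x : Fin N → ℝ} (hf : DifferentiableAt ℝ f x)
    (hh : DifferentiableAt ℝ h x) (i : Fin N) :
    pd i (fun y => f y * h y) x = pd i f x * h x + f x * pd i h x := by
  simp only [pd]
  rw [fderiv_fun_mul hf hh]
  simp
  ring

lemma pd_sum {ι : Type*} {s : Finset ι} {f : ι → (Fin N → ℝ) → ℝ} {x : Fin N → ℝ}
    (hf : ∀ j ∈ s, DifferentiableAt ℝ (f j) x) (i : Fin N) :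
    pd i (fun y => ∑ j ∈ s, f j y) x = ∑ j ∈ s, pd i (f j) x := by
  simp only [pd]
  rw [fderiv_fun_sum hf]
  simp

lemma pd_quadFun_position {x : Fin N → ℝ} {k : Fin N}
    (hT : ∀ j, DifferentiableAt ℝ (fun y => ρ k j y * g j y) x)
    (hv : ∀ j, DifferentiableAt ℝ (v j) x) (p : Fin N → ℝ) (i : Fin N) :
    pd i (fun y => quadFun ℝ g ρ v k y p) x =
      ∑ j, (pd i (fun y => ρ k j y * g j y) x * (p j ^ 2 + v j x) +
        ρ k j x * g j x * pd i (v j) x) := by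
  have hw : ∀ j, DifferentiableAt ℝ (fun y => p j ^ 2 + v j y) x :=
    fun j => (differentiableAt_const _).add (hv j)
  simp only [quadFun, smul_eq_mul, Algebra.algebraMap_self, RingHom.id_apply]
  rw [pd_sum fun j _ => (hT j).fun_mul (hw j)]
  refine Finset.sum_congr rfl fun j _ => ?_
  rw [pd_mul (hT j) (hw j)]
  congr 2
  simp [pd]

lemma pd_quadFun_momentum (k : Fin N) (x p : Fin N → ℝ) (i : Fin N) :
    pd i (quadFun ℝ g ρ v k x) p = 2 * (ρ k i x * g i x) * p i := by
  have hp : ∀ j, DifferentiableAt ℝ (fun y : Fin N → ℝ => y j) p :=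
    fun j => differentiableAt_apply j p
  have : quadFun ℝ g ρ v k x =
      fun p : Fin N → ℝ => ∑ j, (ρ k j x * g j x) * (p j * p j + v j x) := by
    funext p
    simp [quadFun, pow_two]
  rw [this, pd_sum fun j _ =>
    (differentiableAt_const _).fun_mul (((hp j).fun_mul (hp j)).fun_add (differentiableAt_const _))]
  have : ∀ j, pd i (fun y : Fin N → ℝ => ρ k j x * g j x * (y j * y j + v j x)) p =
      if j = i then 2 * (ρ k i x * g i x) * p i else 0 := by
    intro j
    rw [pd_mul (differentiableAt_const _)
      (((hp j).fun_mul (hp j)).fun_add (differentiableAt_const _))]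
    have h1 : pd i (fun y : Fin N → ℝ => y j * y j + v j x) p =
        pd i (fun y : Fin N → ℝ => y j * y j) p := by
      simp [pd]
    have h2 : pd i (fun y : Fin N → ℝ => y j) p = if j = i then 1 else 0 := by
      have : fderiv ℝ (fun y : Fin N → ℝ => y j) p = ContinuousLinearMap.proj j :=
        (ContinuousLinearMap.proj (R := ℝ) (φ := fun _ : Fin N => ℝ) j).fderiv
      simp [pd, this, Pi.single_apply]
    have h3 : pd i (fun _ : Fin N → ℝ => ρ k j x * g j x) p = 0 := by simp [pd]
    rw [h1, pd_mul (hp j) (hp j), h2, h3]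
    split_ifs with hj
    · subst hj; ring
    · ring
  simp [this]

/-- This arranges the bracket in the shape required by `cubic_factor`; the derivatives of the
potentials form the constant terms. -/
lemma poisson_quadFun {x : Fin N → ℝ}
    (hT : ∀ k j, DifferentiableAt ℝ (fun y => ρ k j y * g j y) x)
    (hv : ∀ j, DifferentiableAt ℝ (v j) x) (a k : Fin N) (p : Fin N → ℝ) :
    poisson (quadFun ℝ g ρ v a) (quadFun ℝ g ρ v k) x p =
      ∑ i, p i * (∑ j, (2 * (pd i (fun y => ρ k j y * g j y) x * (ρ a i x * g i x) -
          pd i (fun y => ρ a j y * g j y) x * (ρ k i x * g i x))) * (p j ^ 2 + v j x) +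
        ∑ j, 2 * (ρ k j x * g j x * (ρ a i x * g i x) -
          ρ a j x * g j x * (ρ k i x * g i x)) * pd i (v j) x) := by
  simp only [poisson, pd_quadFun_position (hT _) hv, pd_quadFun_momentum]
  refine Finset.sum_congr rfl fun i _ => ?_
  rw [← Finset.sum_add_distrib, Finset.mul_sum, Finset.sum_mul, Finset.sum_mul,
    ← Finset.sum_sub_distrib]
  refine Finset.sum_congr rfl fun j _ => ?_
  ring

end

/-! ### Structure equations and their pointwise consequences. -/

section

variable {N : ℕ} {U : Set (Fin N → ℝ)} {g : Fin N → (Fin N → ℝ) → ℝ}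
  {ρ : Fin N → Fin N → (Fin N → ℝ) → ℝ} {v : Fin N → (Fin N → ℝ) → ℝ}

/-- At fixed `x` the quadratic functions are images of the rows under one linear map, so a relation
between rows would be one between functions. -/
lemma det_coeffMatrix_ne_zero {x : Fin N → ℝ}
    (hind : LinearIndependent ℝ (fun ℓ => quadFun ℝ g ρ v ℓ x)) :
    (coeffMatrix g ρ x).det ≠ 0 := by
  let Φ : (Fin N → ℝ) →ₗ[ℝ] ((Fin N → ℝ) → ℝ) :=
    { toFun := fun r p => ∑ i, r i * (p i ^ 2 + v i x)
      map_add' := fun r s => by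
        funext p; simp [add_mul, Finset.sum_add_distrib]
      map_smul' := fun a r => by
        funext p; simp [Finset.mul_sum, mul_assoc] }
  have h : LinearIndependent ℝ (coeffMatrix g ρ x).row := by
    refine LinearIndependent.of_comp Φ ?_
    convert hind using 1
    funext ℓ p
    change ∑ i, ρ ℓ i x * g i x * (p i ^ 2 + v i x) = _
    simp [quadFun]
  exact ((Matrix.isUnit_iff_isUnit_det _).1
    (Matrix.linearIndependent_rows_iff_isUnit.1 h)).ne_zero

/-- The structure equations for the coefficients `ρ^{(k)}_j g_j`, at one point. -/
def StructureEquations (g : Fin N → (Fin N → ℝ) → ℝ) (ρ : Fin N → Fin N → (Fin N → ℝ) → ℝ)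
    (l : Fin N) (x : Fin N → ℝ) (b : Fin N → Fin N → ℝ) : Prop :=
  ∀ i k j, pd i (fun y => ρ k j y * g j y) x =
    ρ k i x * pd i (g j) x + b i k * (ρ l j x * g j x)

/-- The hypothesis reads `R y = (∑ⱼ yⱼ) R eᵢ`, so `y` is a multiple of `eᵢ`. -/
lemma eq_zero_of_sum_sub_mul {R : Matrix (Fin N) (Fin N) ℝ} (hR : R.det ≠ 0) {i : Fin N}
    {y : Fin N → ℝ} (h : ∀ k, ∑ j, (R k j - R k i) * y j = 0) {j : Fin N} (hj : j ≠ i) :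
    y j = 0 := by
  have h1 : R.mulVec (y - Pi.single i (∑ j, y j)) = 0 := by
    funext k
    have := h k
    simp only [sub_mul, Finset.sum_sub_distrib, ← Finset.mul_sum] at this
    rw [Matrix.mulVec_sub, Matrix.mulVec_single]
    simp only [Matrix.mulVec, dotProduct, Pi.sub_apply, Pi.smul_apply, Matrix.col_apply,
      Pi.zero_apply, MulOpposite.smul_eq_mul_unop, MulOpposite.unop_op]
    exact this
  have h2 := congrFun (Matrix.eq_zero_of_mulVec_eq_zero hR h1) j
  simpa [hj] using h2

variable {o l : Fin N} {x : Fin N → ℝ}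

/-- In `cubic_factor`, the proportionality of the coefficients is the structure equation, and the
vanishing of the constant terms is a linear system for the `∂ᵢvⱼ`. -/
lemma exists_structureEquations_and_pd_potential
    (hg : ∀ i, ContDiffAt ℝ ∞ (g i) x) (hg0 : ∀ i, g i x ≠ 0)
    (hρ : ∀ ℓ i, ContDiffAt ℝ ∞ (ρ ℓ i) x) (hρ1 : ∀ i, ∀ᶠ y in nhds x, ρ o i y = 1)
    (hv : ∀ i, ContDiffAt ℝ ∞ (v i) x) (hdet : (coeffMatrix g ρ x).det ≠ 0)
    (hconst : ∀ k, ∃ B : MvPolynomial (Fin N) ℝ, ∀ p : Fin N → ℝ,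
      poisson (quadFun ℝ g ρ v o) (quadFun ℝ g ρ v k) x p =
        MvPolynomial.eval p B * quadFun ℝ g ρ v l x p) :
    (∃ b, StructureEquations g ρ l x b) ∧ ∀ i j, j ≠ i → pd i (v j) x = 0 := by
  have hT : ∀ k j, DifferentiableAt ℝ (fun y => ρ k j y * g j y) x := fun k j =>
    ((hρ k j).differentiableAt (by simp)).fun_mul ((hg j).differentiableAt (by simp))
  have hv' : ∀ j, DifferentiableAt ℝ (v j) x := fun j => (hv j).differentiableAt (by simp)
  have hTo : ∀ i j, pd i (fun y => ρ o j y * g j y) x = pd i (g j) x := by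
    intro i j
    have : (fun y => ρ o j y * g j y) =ᶠ[nhds x] g j := by
      filter_upwards [hρ1 j] with y hy
      rw [hy, one_mul]
    simp only [pd, this.fderiv_eq]
  have h1 : ∀ i, ρ o i x = 1 := fun i => (hρ1 i).self_of_nhds
  have ht : (fun j => ρ l j x * g j x) ≠ 0 := by
    intro h0
    exact hdet (Matrix.det_eq_zero_of_row_eq_zero l fun j => congrFun h0 j)
  choose B hB using hconst
  have key := fun k i => by
    refine cubic_factor _ (fun i => ∑ j, 2 * (ρ k j x * g j x * (ρ o i x * g i x) -
          ρ o j x * g j x * (ρ k i x * g i x)) * pd i (v j) x) (fun j => v j x) _ ht (B k)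
      (fun p => (poisson_quadFun hT hv' o k p).symm.trans ((hB k p).trans ?_)) i
    simp [quadFun]
  constructor
  · choose b hb using fun k i => (key k i).2
    -- Row `o` of `T` is `g`, so the bracket carries the common factor `2 gᵢ`.
    refine ⟨fun i k => b k i / (2 * g i x), fun i k j => ?_⟩
    have := hb k i j
    rw [hTo, h1] at this
    have h0 := hg0 i
    field_simp
    linear_combination this
  · intro i j hj
    have hR : (Matrix.of fun k j => ρ k j x).det ≠ 0 := by
      have : coeffMatrix g ρ x =
          (Matrix.of fun k j => ρ k j x) * Matrix.diagonal fun j => g j x := by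
        ext k j
        simp [coeffMatrix]
      rw [this, Matrix.det_mul] at hdet
      exact left_ne_zero_of_mul hdet
    have := eq_zero_of_sum_sub_mul hR (i := i) (y := fun j => g j x * pd i (v j) x) (by
      intro k
      have h2 := (key k i).1
      simp only [h1] at h2
      have h3 : ∑ j, 2 * (ρ k j x * g j x * (1 * g i x) - 1 * g j x * (ρ k i x * g i x)) *
          pd i (v j) x = 2 * g i x * ∑ j, (Matrix.of (fun k j => ρ k j x) k j -
            Matrix.of (fun k j => ρ k j x) k i) * (g j x * pd i (v j) x) := by
        rw [Finset.mul_sum]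
        refine Finset.sum_congr rfl fun j _ => ?_
        simp only [Matrix.of_apply]
        ring
      rw [h3] at h2
      exact (mul_eq_zero.1 h2).resolve_left (mul_ne_zero two_ne_zero (hg0 i))) hj
    exact (mul_eq_zero.1 this).resolve_left (hg0 j)

/-- The right side depends on `j` only through `ρ^{(l)}_j`, so comparing two values of `j`
eliminates `b`. -/
lemma StructureEquations.eisenhart {b : Fin N → Fin N → ℝ} (hb : StructureEquations g ρ l x b)
    (hg : ∀ i, DifferentiableAt ℝ (g i) x) (hg0 : ∀ i, g i x ≠ 0)
    (hρ : ∀ ℓ i, DifferentiableAt ℝ (ρ ℓ i) x) (i k j : Fin N) :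
    pd i (ρ k j) x + (ρ k j x - ρ k i x) * (pd i (g j) x / g j x) = b i k * ρ l j x := by
  have h := hb i k j
  rw [pd_mul (hρ k j) (hg j)] at h
  have h0 := hg0 j
  field_simp
  linear_combination h

/-- The terms `ρ^{(k)}_i ρ^{(a)}_i gᵢ ∂ᵢgⱼ` cancel by antisymmetry in `a` and `k`; what is left is
proportional to row `l`. -/
lemma StructureEquations.involutive {b : Fin N → Fin N → ℝ} (hb : StructureEquations g ρ l x b)
    (hg : ∀ i, DifferentiableAt ℝ (g i) x)
    (hρ : ∀ ℓ i, DifferentiableAt ℝ (ρ ℓ i) x) (hv : ∀ i, DifferentiableAt ℝ (v i) x)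
    (hv0 : ∀ i j, j ≠ i → pd i (v j) x = 0) (a k : Fin N) :
    ∃ B : MvPolynomial (Fin N) ℝ, ∀ p : Fin N → ℝ,
      poisson (quadFun ℝ g ρ v a) (quadFun ℝ g ρ v k) x p =
        MvPolynomial.eval p B * quadFun ℝ g ρ v l x p := by
  refine ⟨∑ i, MvPolynomial.C (2 * (b i k * (ρ a i x * g i x) - b i a * (ρ k i x * g i x))) *
    MvPolynomial.X i, fun p => ?_⟩
  rw [poisson_quadFun (fun k j => (hρ k j).fun_mul (hg j)) hv, map_sum, Finset.sum_mul]
  refine Finset.sum_congr rfl fun i _ => ?_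
  have h1 : ∑ j, 2 * (ρ k j x * g j x * (ρ a i x * g i x) -
      ρ a j x * g j x * (ρ k i x * g i x)) * pd i (v j) x = 0 := by
    refine Finset.sum_eq_zero fun j _ => ?_
    by_cases hj : j = i
    · subst hj; ring
    · rw [hv0 i j hj, mul_zero]
  rw [h1, add_zero]
  simp only [quadFun, smul_eq_mul, Algebra.algebraMap_self, RingHom.id_apply, map_mul,
    MvPolynomial.eval_C, MvPolynomial.eval_X, Finset.mul_sum]
  refine Finset.sum_congr rfl fun j _ => ?_
  rw [hb i k j, hb i a j]
  ring

/-! ### The inverse of the coefficient matrix. -/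

lemma contDiffOn_det {E : Type*} [NormedAddCommGroup E] [NormedSpace ℝ E] {s : Set E}
    {A : E → Matrix (Fin N) (Fin N) ℝ} (hA : ∀ i j, ContDiffOn ℝ ∞ (fun x => A x i j) s) :
    ContDiffOn ℝ ∞ (fun x => (A x).det) s := by
  simp only [Matrix.det_apply]
  exact ContDiffOn.sum fun σ _ => by
    simp only [Units.smul_def, zsmul_eq_mul]
    exact contDiffOn_const.mul (contDiffOn_prod fun i _ => hA _ _)

lemma contDiffOn_matrix_inv {E : Type*} [NormedAddCommGroup E] [NormedSpace ℝ E] {s : Set E}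
    {A : E → Matrix (Fin N) (Fin N) ℝ} (hA : ∀ i j, ContDiffOn ℝ ∞ (fun x => A x i j) s)
    (hdet : ∀ x ∈ s, (A x).det ≠ 0) (i j : Fin N) :
    ContDiffOn ℝ ∞ (fun x => (A x)⁻¹ i j) s := by
  simp only [Matrix.inv_def, Ring.inverse_eq_inv', Matrix.smul_apply, Matrix.adjugate_apply]
  refine ((contDiffOn_det hA).inv hdet).smul (contDiffOn_det fun a b => ?_)
  by_cases ha : a = j
  · subst ha
    simp only [Matrix.updateRow_self]
    exact contDiffOn_const
  · simp only [Matrix.updateRow_ne ha]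
    exact hA a b

/-- Outside the last column, the `j`-th row of the inverse matrix depends on `xʲ` only. -/
lemma StructureEquations.pd_inv_eq_zero {b : Fin N → Fin N → ℝ}
    (hb : StructureEquations g ρ l x b) (hU : IsOpen U) (hx : x ∈ U)
    (hT : ∀ k j, ContDiffOn ℝ ∞ (fun y => ρ k j y * g j y) U) (hg0 : ∀ i, g i x ≠ 0)
    (hdet : ∀ y ∈ U, (coeffMatrix g ρ y).det ≠ 0) {ξ : Fin N} (hξ : ξ ≠ l) {i j : Fin N}
    (hj : j ≠ i) : pd i (fun y => (coeffMatrix g ρ y)⁻¹ j ξ) x = 0 := by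
  have hTd : ∀ k j, DifferentiableAt ℝ (fun y => ρ k j y * g j y) x := fun k j =>
    ((hT k j).contDiffAt (hU.mem_nhds hx)).differentiableAt (by simp)
  have hS : ∀ j, DifferentiableAt ℝ (fun y => (coeffMatrix g ρ y)⁻¹ j ξ) x := fun j =>
    ((contDiffOn_matrix_inv (A := coeffMatrix g ρ) hT hdet j ξ).contDiffAt
      (hU.mem_nhds hx)).differentiableAt (by simp)
  have hprod : ∀ y ∈ U, ∀ k, ∑ j, (ρ k j y * g j y) * (coeffMatrix g ρ y)⁻¹ j ξ =
      if k = ξ then 1 else 0 := by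
    intro y hy k
    have := congrFun (congrFun (Matrix.mul_nonsing_inv (coeffMatrix g ρ y)
      (isUnit_iff_ne_zero.2 (hdet y hy))) k) ξ
    rwa [Matrix.mul_apply, Matrix.one_apply] at this
  have hder : ∀ k, ∑ j, (pd i (fun y => ρ k j y * g j y) x * (coeffMatrix g ρ x)⁻¹ j ξ +
      ρ k j x * g j x * pd i (fun y => (coeffMatrix g ρ y)⁻¹ j ξ) x) = 0 := by
    intro k
    have h1 : (fun y => ∑ j, (ρ k j y * g j y) * (coeffMatrix g ρ y)⁻¹ j ξ) =ᶠ[nhds x]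
        fun _ => if k = ξ then 1 else 0 := by
      filter_upwards [hU.mem_nhds hx] with y hy using hprod y hy k
    have h2 : pd i (fun y => ∑ j, (ρ k j y * g j y) * (coeffMatrix g ρ y)⁻¹ j ξ) x = 0 := by
      simp only [pd, h1.fderiv_eq]
      simp
    rw [pd_sum fun j _ => (hTd k j).fun_mul (hS j)] at h2
    rw [← h2]
    exact Finset.sum_congr rfl fun j _ => (pd_mul (hTd k j) (hS j) i).symm
  let D : Fin N → ℝ := fun j => pd i (fun y => (coeffMatrix g ρ y)⁻¹ j ξ) x
  -- Chosen so that `c` times column `i` of `T` equals `-ρ^{(k)}_i ∑ⱼ ∂ᵢgⱼ S_{jξ}`, the only part of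
  -- `-(∂ᵢT) S` that survives in column `ξ`.
  let c : ℝ := -(∑ j, pd i (g j) x * (coeffMatrix g ρ x)⁻¹ j ξ) / g i x
  -- Here `ξ ≠ l` is essential: it removes the unknown `b`.
  have hlast : ∑ j, (ρ l j x * g j x) * (coeffMatrix g ρ x)⁻¹ j ξ = 0 := by
    rw [hprod x hx l, if_neg hξ.symm]
  have h0 : (coeffMatrix g ρ x).mulVec (D - Pi.single i c) = 0 := by
    funext k
    rw [Matrix.mulVec_sub, Matrix.mulVec_single]
    simp only [Matrix.mulVec, dotProduct, Pi.sub_apply, Pi.smul_apply, Matrix.col_apply,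
      Pi.zero_apply, MulOpposite.smul_eq_mul_unop, MulOpposite.unop_op]
    have h1 := hder k
    simp only [hb i k] at h1
    have h2 : ∑ j, ((ρ k i x * pd i (g j) x + b i k * (ρ l j x * g j x)) *
          (coeffMatrix g ρ x)⁻¹ j ξ + ρ k j x * g j x * D j) =
        ρ k i x * (∑ j, pd i (g j) x * (coeffMatrix g ρ x)⁻¹ j ξ) +
          b i k * (∑ j, (ρ l j x * g j x) * (coeffMatrix g ρ x)⁻¹ j ξ) +
          ∑ j, ρ k j x * g j x * D j := by
      rw [Finset.mul_sum, Finset.mul_sum, ← Finset.sum_add_distrib, ← Finset.sum_add_distrib]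
      refine Finset.sum_congr rfl fun j _ => ?_
      ring
    rw [h2, hlast] at h1
    have h3 : coeffMatrix g ρ x k i * c =
        -(ρ k i x * ∑ j, pd i (g j) x * (coeffMatrix g ρ x)⁻¹ j ξ) := by
      have := hg0 i
      simp only [coeffMatrix, Matrix.of_apply, c]
      field_simp
    rw [h3]
    simp only [coeffMatrix, Matrix.of_apply] at h1 ⊢
    linarith
  have h1 := congrFun (Matrix.eq_zero_of_mulVec_eq_zero (hdet x hx) h0) j
  simpa [hj] using h1

/-! ### Functions of one coordinate on a box. -/

lemma IsOpenBox.isOpen {Q : Set (Fin N → ℝ)} (hQ : IsOpenBox Q) : IsOpen Q := by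
  obtain ⟨I, hI, rfl⟩ := hQ
  exact isOpen_set_pi Set.finite_univ fun i _ => (hI i).1

lemma IsOpenBox.convex {Q : Set (Fin N → ℝ)} (hQ : IsOpenBox Q) : Convex ℝ Q := by
  obtain ⟨I, hI, rfl⟩ := hQ
  exact convex_pi fun i _ => (hI i).2.convex

/-- By convexity the segment from `x` to `y` stays in the box, and its direction has no `j`-th
component. -/
lemma eq_of_pd_eq_zero {Q : Set (Fin N → ℝ)} (hQ : IsOpenBox Q) {f : (Fin N → ℝ) → ℝ}
    (hf : DifferentiableOn ℝ f Q) {j : Fin N} (h0 : ∀ x ∈ Q, ∀ i, i ≠ j → pd i f x = 0)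
    {x y : Fin N → ℝ} (hx : x ∈ Q) (hy : y ∈ Q) (hxy : x j = y j) : f x = f y := by
  have hl : ∀ t ∈ Set.Icc (0 : ℝ) 1, AffineMap.lineMap x y t ∈ Q := fun t ht =>
    hQ.convex.lineMap_mem hx hy ht
  have hd : ∀ t ∈ Set.Icc (0 : ℝ) 1,
      HasDerivAt (fun t : ℝ => f (AffineMap.lineMap x y t)) 0 t := by
    intro t ht
    have h1 := (hf.differentiableAt (hQ.isOpen.mem_nhds (hl t ht))).hasFDerivAt
    have h2 := h1.comp_hasDerivAt t (AffineMap.hasDerivAt_lineMap (a := x) (b := y) (x := t))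
    refine h2.congr_deriv ?_
    have h3 : y - x = ∑ i, (y i - x i) • (Pi.single i (1 : ℝ) : Fin N → ℝ) := by
      funext k
      simp [Finset.sum_apply, Pi.single_apply]
    rw [h3, map_sum]
    refine Finset.sum_eq_zero fun i _ => ?_
    rw [map_smul]
    by_cases hi : i = j
    · subst hi; simp [hxy]
    · have := h0 _ (hl t ht) i hi
      simp only [pd] at this
      rw [this, smul_zero]
  have := constant_of_has_deriv_right_zero (f := fun t : ℝ => f (AffineMap.lineMap x y t))
    (a := 0) (b := 1) (fun t ht => (hd t ht).continuousAt.continuousWithinAt)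
    (fun t ht => (hd t ⟨ht.1, ht.2.le⟩).hasDerivWithinAt) 1 (by simp)
  simpa using this.symm

lemma IsOpenBox.update_mem {Q : Set (Fin N → ℝ)} (hQ : IsOpenBox Q) {q x : Fin N → ℝ}
    (hq : q ∈ Q) (hx : x ∈ Q) (i : Fin N) : Function.update q i (x i) ∈ Q := by
  obtain ⟨I, hI, rfl⟩ := hQ
  intro j _
  by_cases hj : j = i
  · subst hj; simpa using hx j trivial
  · simpa [hj] using hq j trivial

end

/-! ### Parameter integrals and square roots. -/

section

open Set intervalIntegral in
-- The tube lemma bounds the derivative uniformly near the compact segment over `e`, which permits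
-- dominated differentiation. Over `ℂ` this yields holomorphy in the parameters.
lemma hasFDerivAt_integral_of_continuousOn {𝕜 : Type*} [RCLike 𝕜] {H F : Type*}
    [NormedAddCommGroup H] [NormedSpace 𝕜 H] [NormedAddCommGroup F] [NormedSpace ℝ F]
    [NormedSpace 𝕜 F] {D : Set (H × ℝ)} (hD : IsOpen D) {f : H × ℝ → F}
    {f' : H × ℝ → H →L[𝕜] F} (hf : ContinuousOn f D) (hf' : ContinuousOn f' D)
    (hd : ∀ z ∈ D, HasFDerivAt (fun e => f (e, z.2)) (f' z) z.1) {e : H} {a b : ℝ}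
    (he : ∀ t ∈ uIcc a b, (e, t) ∈ D) :
    HasFDerivAt (fun e => ∫ t in a..b, f (e, t)) (∫ t in a..b, f' (e, t)) e := by
  have hK : IsCompact (({e} : Set H) ×ˢ uIcc a b) := isCompact_singleton.prod isCompact_uIcc
  have hKD : ({e} : Set H) ×ˢ uIcc a b ⊆ D := by
    rintro ⟨e', t⟩ ⟨h1, h2⟩
    rw [mem_singleton_iff] at h1
    subst h1
    exact he t h2
  obtain ⟨M, hM⟩ := hK.exists_bound_of_continuousOn (hf'.mono hKD)
  have hD' : IsOpen (D ∩ (fun z => ‖f' z‖) ⁻¹' Iio (M + 1)) :=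
    hf'.norm.isOpen_inter_preimage hD isOpen_Iio
  obtain ⟨u, w, hu, -, heu, htw, huw⟩ := generalized_tube_lemma isCompact_singleton isCompact_uIcc
    hD' (s := {e}) (t := uIcc a b) fun z hz =>
      ⟨hKD hz, (hM z hz).trans_lt (by simp)⟩
  have heu : e ∈ u := heu rfl
  have huw' : ∀ e' ∈ u, ∀ t ∈ uIcc a b, (e', t) ∈ D ∧ ‖f' (e', t)‖ < M + 1 :=
    fun e' he' t ht => huw ⟨he', htw ht⟩
  have hline : ∀ e' ∈ u, ContinuousOn (fun t => f (e', t)) (uIcc a b) := fun e' he' =>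
    hf.comp (by fun_prop) fun t ht => (huw' e' he' t ht).1
  have hline' : ContinuousOn (fun t => f' (e, t)) (uIcc a b) :=
    hf'.comp (by fun_prop) fun t ht => (huw' e heu t ht).1
  refine hasFDerivAt_integral_of_dominated_of_fderiv_le (s := u) (bound := fun _ => M + 1)
    (F := fun e t => f (e, t)) (F' := fun e t => f' (e, t)) (hu.mem_nhds heu) ?_ ?_ ?_ ?_ ?_ ?_
  · filter_upwards [hu.mem_nhds heu] with e' he'
    exact ((hline e' he').mono uIoc_subset_uIcc).aestronglyMeasurable measurableSet_uIoc
  · exact (hline e heu).intervalIntegrable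
  · exact (hline'.mono uIoc_subset_uIcc).aestronglyMeasurable measurableSet_uIoc
  · exact Filter.Eventually.of_forall fun t ht e' he' =>
      (huw' e' he' t (uIoc_subset_uIcc ht)).2.le
  · exact intervalIntegrable_const
  · exact Filter.Eventually.of_forall fun t ht e' he' =>
      hd _ (huw' e' he' t (uIoc_subset_uIcc ht)).1

open Set in
-- Induction on the order: the derivative is an integral of the same kind with values in `E →L[ℝ]
-- F`, hence the generalization over `F`.
lemma contDiffOn_integral_of_contDiffOn {E : Type} [NormedAddCommGroup E] [NormedSpace ℝ E]
    {V : Set E} (hV : IsOpen V) {D : Set (E × ℝ)} (hD : IsOpen D) {a b : ℝ}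
    (hVD : ∀ e ∈ V, ∀ t ∈ uIcc a b, (e, t) ∈ D) {F : Type} [NormedAddCommGroup F]
    [NormedSpace ℝ F] {f : E × ℝ → F} (hf : ContDiffOn ℝ ∞ f D) :
    ContDiffOn ℝ ∞ (fun e => ∫ t in a..b, f (e, t)) V := by
  rw [contDiffOn_infty]
  intro n
  induction n generalizing F with
  | zero =>
    refine contDiffOn_zero.2 fun e he => ?_
    refine (hasFDerivAt_integral_of_continuousOn (𝕜 := ℝ) hD hf.continuousOn
      (f' := fun z => (fderiv ℝ f z).comp (ContinuousLinearMap.inl ℝ E ℝ)) ?_ ?_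
      (hVD e he)).continuousAt.continuousWithinAt
    · exact ((hf.continuousOn_fderiv_of_isOpen hD (by simp)).clm_comp continuousOn_const)
    · intro z hz
      exact ((hf.contDiffAt (hD.mem_nhds hz)).differentiableAt
        (by simp)).hasFDerivAt.comp z.1 (hasFDerivAt_prodMk_left z.1 z.2)
  | succ n ih =>
    have hf' : ContDiffOn ℝ ∞ (fun z => (fderiv ℝ f z).comp (ContinuousLinearMap.inl ℝ E ℝ)) D :=
      (hf.fderiv_of_isOpen hD (by simp)).clm_comp contDiffOn_const
    have hd : ∀ e ∈ V, HasFDerivAt (fun e => ∫ t in a..b, f (e, t))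
        (∫ t in a..b, (fderiv ℝ f (e, t)).comp (ContinuousLinearMap.inl ℝ E ℝ)) e := by
      intro e he
      refine hasFDerivAt_integral_of_continuousOn (𝕜 := ℝ) hD hf.continuousOn
        (f' := fun z => (fderiv ℝ f z).comp (ContinuousLinearMap.inl ℝ E ℝ)) hf'.continuousOn
        (fun z hz => ?_) (hVD e he)
      exact ((hf.contDiffAt (hD.mem_nhds hz)).differentiableAt
        (by simp)).hasFDerivAt.comp z.1 (hasFDerivAt_prodMk_left z.1 z.2)
    rw [show ((n + 1 : ℕ) : WithTop ℕ∞) = (n : WithTop ℕ∞) + 1 by norm_cast,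
      contDiffOn_succ_iff_fderiv_of_isOpen hV]
    refine ⟨fun e he => (hd e he).differentiableAt.differentiableWithinAt,
      fun h => absurd h (by simp), (ih hf').congr fun e he => (hd e he).fderiv⟩

open Set in
/-- Smooth dependence of a primitive on its endpoint and on parameters. -/
lemma contDiffOn_primitive {C : Type} [NormedAddCommGroup C] [NormedSpace ℝ C] {F : Type}
    [NormedAddCommGroup F] [NormedSpace ℝ F] {J : Set ℝ} (hJ : IsOpen J) (hJc : J.OrdConnected)
    {a : ℝ} (ha : a ∈ J) {Λ : Set C} (hΛ : IsOpen Λ) {G : ℝ × C → F}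
    (hG : ContDiffOn ℝ ∞ G (J ×ˢ Λ)) :
    ContDiffOn ℝ ∞ (fun z : ℝ × C => ∫ τ in a..z.1, G (τ, z.2)) (J ×ˢ Λ) := by
  -- Rescaling to `[0, 1]` turns the variable endpoint into a parameter.
  have heq : (fun z : ℝ × C => ∫ τ in a..z.1, G (τ, z.2)) = fun z =>
      (z.1 - a) • ∫ τ in (0 : ℝ)..1, G (a + (z.1 - a) * τ, z.2) := by
    funext z
    rw [intervalIntegral.smul_integral_comp_add_mul (fun τ => G (τ, z.2))]
    simp
  rw [heq]
  have hm : ContDiff ℝ ∞ fun w : (ℝ × C) × ℝ => (a + (w.1.1 - a) * w.2, w.1.2) := by fun_prop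
  refine ContDiffOn.smul (by fun_prop) (contDiffOn_integral_of_contDiffOn (hJ.prod hΛ)
    (D := (fun w : (ℝ × C) × ℝ => (a + (w.1.1 - a) * w.2, w.1.2)) ⁻¹' (J ×ˢ Λ))
    ((hJ.prod hΛ).preimage hm.continuous) ?_
    (f := fun w => G (a + (w.1.1 - a) * w.2, w.1.2)) (hG.comp hm.contDiffOn fun w hw => hw))
  rintro ⟨t, c⟩ ⟨ht, hc⟩ τ hτ
  rw [uIcc_of_le zero_le_one] at hτ
  have := hJc.convex.add_smul_sub_mem ha ht hτ
  refine ⟨?_, hc⟩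
  simpa [mul_comm] using this

/-- A smooth branch of the square root near a nonzero square. -/
lemma exists_sqrt_branch {𝕜 : Type*} [RCLike 𝕜] {p : 𝕜} (hp : p ≠ 0) :
    ∃ (W : Set 𝕜) (s : 𝕜 → 𝕜), IsOpen W ∧ p ^ 2 ∈ W ∧ ContDiffOn 𝕜 ∞ s W ∧ s (p ^ 2) = p ∧
      ∀ z ∈ W, s z ^ 2 = z ∧ s z ≠ 0 := by
  have h2 : (2 : 𝕜) * p ≠ 0 := mul_ne_zero two_ne_zero hp
  -- Analyticity at a point persists nearby, so the local inverse is smooth on a whole open set.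
  have hf : ContDiffAt 𝕜 ω (fun z : 𝕜 => z ^ 2) p := contDiffAt_id.pow 2
  have hd : HasFDerivAt (fun z : 𝕜 => z ^ 2)
      (ContinuousLinearEquiv.unitsEquivAut 𝕜 (Units.mk0 _ h2) : 𝕜 →L[𝕜] 𝕜) p := by
    have := (hasDerivAt_pow 2 p).hasFDerivAt
    convert this using 1
    ext
    simp
  have hs := hf.to_localInverse hd (by simp)
  have hsp := hf.localInverse_apply_image hd (by simp)
  have hsq : ∀ᶠ z in nhds (p ^ 2), hf.localInverse hd (by simp) z ^ 2 = z :=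
    (hf.hasStrictFDerivAt' hd (by simp)).eventually_right_inverse
  have han : ∀ᶠ z in nhds (p ^ 2), AnalyticAt 𝕜 (hf.localInverse hd (by simp)) z :=
    hs.analyticAt.eventually_analyticAt
  have hne : ∀ᶠ z in nhds (p ^ 2), z ≠ 0 := isOpen_ne.mem_nhds (pow_ne_zero 2 hp)
  obtain ⟨W, hW, hWo, hpW⟩ := eventually_nhds_iff.1 (hsq.and (han.and hne))
  refine ⟨W, hf.localInverse hd (by simp), hWo, hpW,
    fun z hz => (hW z hz).2.1.contDiffAt.contDiffWithinAt, hsp, fun z hz => ⟨(hW z hz).1, ?_⟩⟩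
  intro h0
  have := (hW z hz).1
  rw [h0] at this
  exact (hW z hz).2.2 (by simpa using this.symm)

end

/-! ### Separated solutions on a box. -/

section

open Set

lemma contDiffOn_one_primitive {F : Type*} [NormedAddCommGroup F] [NormedSpace ℝ F]
    [CompleteSpace F] {J : Set ℝ} (hJ : IsOpen J) (hJc : J.OrdConnected) {a : ℝ} (ha : a ∈ J)
    {f : ℝ → F} (hf : ContinuousOn f J) :
    (∀ t ∈ J, HasDerivAt (fun t => ∫ τ in a..t, f τ) (f t) t) ∧
      ContDiffOn ℝ 1 (fun t => ∫ τ in a..t, f τ) J := by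
  have hd : ∀ t ∈ J, HasDerivAt (fun t => ∫ τ in a..t, f τ) (f t) t := fun t ht =>
    intervalIntegral.integral_hasDerivAt_right
      ((hf.mono (hJc.uIcc_subset ha ht)).intervalIntegrable)
      (hf.stronglyMeasurableAtFilter hJ t ht) (hf.continuousAt (hJ.mem_nhds ht))
  refine ⟨hd, ?_⟩
  rw [show (1 : WithTop ℕ∞) = 0 + 1 by simp, contDiffOn_succ_iff_deriv_of_isOpen hJ]
  exact ⟨fun t ht => (hd t ht).differentiableAt.differentiableWithinAt,
    fun h => absurd h (by simp),
    contDiffOn_zero.2 (hf.congr fun t ht => (hd t ht).deriv)⟩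

lemma pd_separated {N : ℕ} {F : Type*} [NormedAddCommGroup F] [NormedSpace ℝ F]
    {φ : Fin N → ℝ → F} {d : Fin N → F} {x : Fin N → ℝ}
    (h : ∀ i, HasDerivAt (φ i) (d i) (x i)) (i : Fin N) :
    pd i (fun y => ∑ j, φ j (y j)) x = d i := by
  have hj : ∀ j, HasFDerivAt (fun y : Fin N → ℝ => φ j (y j))
      ((ContinuousLinearMap.toSpanSingleton ℝ (d j)).comp
        (ContinuousLinearMap.proj (R := ℝ) (φ := fun _ : Fin N => ℝ) j)) x := fun j =>
    (h j).hasFDerivAt.comp x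
      (ContinuousLinearMap.proj (R := ℝ) (φ := fun _ : Fin N => ℝ) j).hasFDerivAt
  have := HasFDerivAt.fun_sum (u := Finset.univ) fun j _ => hj j
  simp only [pd, this.fderiv]
  simp [Pi.single_apply, ite_smul]

lemma sum_mul_sum_inv {𝕜 : Type*} [RCLike 𝕜] {N : ℕ} {A : Matrix (Fin N) (Fin N) ℝ}
    (hA : A.det ≠ 0) (c : Fin N → 𝕜) (ℓ : Fin N) :
    ∑ i, A ℓ i • ∑ ξ, A⁻¹ i ξ • c ξ = c ℓ := by
  have h := fun ξ => congrFun (congrFun (Matrix.mul_nonsing_inv A (isUnit_iff_ne_zero.2 hA)) ℓ) ξ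
  simp only [Matrix.mul_apply, Matrix.one_apply] at h
  simp only [Finset.smul_sum, smul_smul]
  rw [Finset.sum_comm]
  simp only [← Finset.sum_smul, h]
  simp

variable {n : ℕ} {U : Set (Fin (n + 2) → ℝ)} {g : Fin (n + 2) → (Fin (n + 2) → ℝ) → ℝ}
  {ρ : Fin (n + 2) → Fin (n + 2) → (Fin (n + 2) → ℝ) → ℝ}
  {v : Fin (n + 2) → (Fin (n + 2) → ℝ) → ℝ}

/-- On the box `∏ᵢ Iᵢ`, the functions `aᵢξ` and `bᵢ` of one variable are the entries of the inverse
coefficient matrix (without its last column) and the functions `vᵢ`. -/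
structure SeparatedData (g : Fin (n + 2) → (Fin (n + 2) → ℝ) → ℝ)
    (ρ : Fin (n + 2) → Fin (n + 2) → (Fin (n + 2) → ℝ) → ℝ)
    (v : Fin (n + 2) → (Fin (n + 2) → ℝ) → ℝ) (I : Fin (n + 2) → Set ℝ)
    (a : Fin (n + 2) → Fin (n + 1) → ℝ → ℝ) (b : Fin (n + 2) → ℝ → ℝ) : Prop where
  isOpen : ∀ i, IsOpen (I i)
  ordConnected : ∀ i, (I i).OrdConnected
  det_ne_zero : ∀ x ∈ univ.pi I, (coeffMatrix g ρ x).det ≠ 0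
  smooth_inv : ∀ i ξ, ContDiffOn ℝ ∞ (a i ξ) (I i)
  smooth_potential : ∀ i, ContDiffOn ℝ ∞ (b i) (I i)
  inv_eq : ∀ x ∈ univ.pi I, ∀ i ξ, (coeffMatrix g ρ x)⁻¹ i (Fin.castSucc ξ) = a i ξ (x i)
  potential_eq : ∀ x ∈ univ.pi I, ∀ i, v i x = b i (x i)

lemma exists_separatedData
    (hT : ∀ k j, ContDiffOn ℝ ∞ (fun y => ρ k j y * g j y) U)
    (hdet : ∀ x ∈ U, (coeffMatrix g ρ x).det ≠ 0) (hv : ∀ i, ContDiffOn ℝ ∞ (v i) U)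
    (hS0 : ∀ x ∈ U, ∀ (ξ : Fin (n + 1)) i j, j ≠ i →
      pd i (fun y => (coeffMatrix g ρ y)⁻¹ j ξ.castSucc) x = 0)
    (hv0 : ∀ x ∈ U, ∀ i j, j ≠ i → pd i (v j) x = 0)
    {I : Fin (n + 2) → Set ℝ} (hI : ∀ i, IsOpen (I i) ∧ (I i).OrdConnected)
    (hIU : univ.pi I ⊆ U) : ∃ a b, SeparatedData g ρ v I a b := by
  have hS : ∀ i ξ, ContDiffOn ℝ ∞ (fun x => (coeffMatrix g ρ x)⁻¹ i ξ) (univ.pi I) := fun i ξ =>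
    (contDiffOn_matrix_inv (A := coeffMatrix g ρ) hT hdet i ξ).mono hIU
  have hQ : IsOpenBox (univ.pi I) := ⟨I, hI, rfl⟩
  rcases (univ.pi I).eq_empty_or_nonempty with h0 | ⟨q, hq⟩
  · exact ⟨fun _ _ _ => 0, fun _ _ => 0, fun i => (hI i).1, fun i => (hI i).2, by simp [h0],
      fun _ _ => contDiffOn_const, fun _ => contDiffOn_const, by simp [h0], by simp [h0]⟩
  · have hu : ∀ i, ContDiff ℝ ∞ fun t : ℝ => Function.update q i t := fun i =>
      contDiff_update ∞ q i
    have hm : ∀ i, MapsTo (fun t : ℝ => Function.update q i t) (I i) (univ.pi I) := by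
      intro i t ht j _
      by_cases hj : j = i
      · subst hj; simpa using ht
      · simpa [hj] using hq j trivial
    -- The one-variable functions are read off on the coordinate lines through the base point `q`.
    refine ⟨fun i ξ t => (coeffMatrix g ρ (Function.update q i t))⁻¹ i ξ.castSucc,
      fun i t => v i (Function.update q i t), fun i => (hI i).1, fun i => (hI i).2,
      fun x hx => hdet x (hIU hx),
      fun i ξ => (hS i ξ.castSucc).comp (hu i).contDiffOn (hm i),
      fun i => ((hv i).mono hIU).comp (hu i).contDiffOn (hm i), fun x hx i ξ => ?_,
      fun x hx i => ?_⟩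
    · exact eq_of_pd_eq_zero hQ (f := fun x => (coeffMatrix g ρ x)⁻¹ i ξ.castSucc)
        ((hS i ξ.castSucc).differentiableOn (by simp))
        (fun y hy k hk => hS0 y (hIU hy) ξ k i hk.symm) hx (hQ.update_mem hq hx i) (by simp)
    · exact eq_of_pd_eq_zero hQ (((hv i).mono hIU).differentiableOn (by simp))
        (fun y hy k hk => hv0 y (hIU hy) k i hk.symm) hx (hQ.update_mem hq hx i) (by simp)

variable {I : Fin (n + 2) → Set ℝ} {a : Fin (n + 2) → Fin (n + 1) → ℝ → ℝ}
  {b : Fin (n + 2) → ℝ → ℝ}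

/-- The squares of the momenta `∂ᵢu` of a separated solution, as functions of `xⁱ`. -/
def momentumSq {𝕜 : Type*} [RCLike 𝕜] (a : Fin (n + 2) → Fin (n + 1) → ℝ → ℝ)
    (b : Fin (n + 2) → ℝ → ℝ) (i : Fin (n + 2)) (t : ℝ) (c : Fin (n + 1) → 𝕜) : 𝕜 :=
  ∑ ξ, a i ξ t • c ξ - algebraMap ℝ 𝕜 (b i t)

/-- The assumption on `p` says `p² + v = T⁻¹ (c, 0)`; applying `T` gives the values. -/
lemma SeparatedData.quadFun_eq {𝕜 : Type*} [RCLike 𝕜] (h : SeparatedData g ρ v I a b)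
    {x : Fin (n + 2) → ℝ} (hx : x ∈ univ.pi I) {c : Fin (n + 1) → 𝕜} {p : Fin (n + 2) → 𝕜}
    (hp : ∀ i, p i ^ 2 = momentumSq a b i (x i) c) (ℓ : Fin (n + 2)) :
    quadFun 𝕜 g ρ v ℓ x p = Fin.snoc (α := fun _ => 𝕜) c 0 ℓ := by
  rw [← sum_mul_sum_inv (h.det_ne_zero x hx) (Fin.snoc (α := fun _ => 𝕜) c 0) ℓ]
  refine Finset.sum_congr rfl fun i _ => ?_
  simp only [hp, momentumSq, Fin.sum_univ_castSucc, Fin.snoc_castSucc, Fin.snoc_last, smul_zero,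
    h.inv_eq x hx, h.potential_eq x hx, sub_add_cancel, add_zero]
  rfl

/-- This is the converse of `quadFun_eq`; it fixes the parameters belonging to a prescribed point of
the side condition. -/
lemma SeparatedData.momentumSq_eq {𝕜 : Type*} [RCLike 𝕜] (h : SeparatedData g ρ v I a b)
    {x : Fin (n + 2) → ℝ} (hx : x ∈ univ.pi I) {p : Fin (n + 2) → 𝕜}
    (hp : quadFun 𝕜 g ρ v (Fin.last (n + 1)) x p = 0) (i : Fin (n + 2)) :
    momentumSq a b i (x i) (fun ξ => quadFun 𝕜 g ρ v ξ.castSucc x p) = p i ^ 2 := by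
  have hdet : (coeffMatrix g ρ x)⁻¹.det ≠ 0 := by
    rw [Matrix.det_nonsing_inv]
    simpa using h.det_ne_zero x hx
  have h1 := sum_mul_sum_inv hdet (fun i => p i ^ 2 + algebraMap ℝ 𝕜 (v i x)) i
  rw [Matrix.nonsing_inv_nonsing_inv _ (isUnit_iff_ne_zero.2 (h.det_ne_zero x hx))] at h1
  have h2 : ∀ ξ, ∑ i, coeffMatrix g ρ x ξ i • (p i ^ 2 + algebraMap ℝ 𝕜 (v i x)) =
      quadFun 𝕜 g ρ v ξ x p := fun ξ => rfl
  simp only [h2] at h1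
  rw [Fin.sum_univ_castSucc, hp, smul_zero, add_zero] at h1
  simp only [h.inv_eq x hx] at h1
  rw [momentumSq, h1, h.potential_eq x hx]
  ring

/-- Any continuous choice of square roots can be integrated, so zeros of the momenta are allowed. -/
lemma SeparatedData.isSeparatedSolution {𝕜 : Type*} [RCLike 𝕜] (h : SeparatedData g ρ v I a b)
    {J : Fin (n + 2) → Set ℝ} (hJI : ∀ i, J i ⊆ I i) (hJ : ∀ i, IsOpen (J i))
    (hJc : ∀ i, (J i).OrdConnected) {q : Fin (n + 2) → ℝ} (hq : q ∈ univ.pi J)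
    {c : Fin (n + 1) → 𝕜} {f : Fin (n + 2) → ℝ → 𝕜} (hf : ∀ i, ContinuousOn (f i) (J i))
    (hsq : ∀ i, ∀ t ∈ J i, f i t ^ 2 = momentumSq a b i t c) :
    (∀ x ∈ univ.pi J, ∀ i, pd i (fun y => ∑ j, ∫ τ in q j..y j, f j τ) x = f i (x i)) ∧
      IsSeparatedSolution 𝕜 (quadFun 𝕜 g ρ v) (univ.pi J) c
        (fun y => ∑ j, ∫ τ in q j..y j, f j τ) := by
  have hprim := fun i => contDiffOn_one_primitive (hJ i) (hJc i) (hq i trivial) (hf i)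
  have hpd : ∀ x ∈ univ.pi J, ∀ i,
      pd i (fun y => ∑ j, ∫ τ in q j..y j, f j τ) x = f i (x i) := fun x hx i =>
    pd_separated (φ := fun j t => ∫ τ in q j..t, f j τ) (d := fun j => f j (x j))
      (fun j => (hprim j).1 _ (hx j trivial)) i
  have hL : ∀ x ∈ univ.pi J, ∀ ℓ, quadFun 𝕜 g ρ v ℓ x
      (fun i => pd i (fun y => ∑ j, ∫ τ in q j..y j, f j τ) x) =
        Fin.snoc (α := fun _ => 𝕜) c 0 ℓ := fun x hx ℓ => by
    simp only [hpd x hx]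
    exact h.quadFun_eq (fun i _ => hJI i (hx i trivial)) (fun i => hsq i _ (hx i trivial)) ℓ
  have hs : ∀ x ∈ univ.pi J, ∀ ξ : Fin (n + 1), quadFun 𝕜 g ρ v ξ.castSucc x
      (fun i => pd i (fun y => ∑ j, ∫ τ in q j..y j, f j τ) x) = c ξ := fun x hx ξ => by
    rw [hL x hx, Fin.snoc_castSucc]
  refine ⟨hpd, ⟨?_, ⟨fun i t => ∫ τ in q i..t, f i τ, fun x _ => rfl⟩, fun x hx => hs x hx 0,
    fun x hx => ?_, hs⟩⟩
  · exact ContDiffOn.sum fun j _ =>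
      (hprim j).2.comp (contDiff_apply ℝ ℝ j).contDiffOn fun x hx => hx j trivial
  · rw [hL x hx, Fin.snoc_last]

lemma SeparatedData.contDiffOn_momentumSq {𝕜 : Type*} [RCLike 𝕜] (h : SeparatedData g ρ v I a b)
    (i : Fin (n + 2)) :
    ContDiffOn ℝ ∞ (fun z : ℝ × (Fin (n + 1) → 𝕜) => momentumSq a b i z.1 z.2)
      (I i ×ˢ univ) := by
  have h1 : MapsTo (Prod.fst : ℝ × (Fin (n + 1) → 𝕜) → ℝ) (I i ×ˢ univ) (I i) :=
    fun z hz => hz.1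
  refine (ContDiffOn.sum fun ξ _ => ?_).sub ?_
  · exact ((h.smooth_inv i ξ).comp contDiffOn_fst h1).smul (by fun_prop)
  · exact (RCLike.ofRealCLM (K := 𝕜)).contDiff.comp_contDiffOn
      ((h.smooth_potential i).comp contDiffOn_fst h1)

lemma hasFDerivAt_momentumSq {𝕜 : Type*} [RCLike 𝕜] (i : Fin (n + 2)) (t : ℝ)
    (c : Fin (n + 1) → 𝕜) :
    HasFDerivAt (momentumSq a b i t) (∑ ξ, algebraMap ℝ 𝕜 (a i ξ t) •
      ContinuousLinearMap.proj (R := 𝕜) (φ := fun _ : Fin (n + 1) => 𝕜) ξ) c := by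
  have h : momentumSq a b i t = fun c : Fin (n + 1) → 𝕜 =>
      (∑ ξ, algebraMap ℝ 𝕜 (a i ξ t) •
        ContinuousLinearMap.proj (R := 𝕜) (φ := fun _ : Fin (n + 1) => 𝕜) ξ) c -
      algebraMap ℝ 𝕜 (b i t) := by
    funext c
    simp [momentumSq, Algebra.smul_def]
  rw [h]
  exact (ContinuousLinearMap.hasFDerivAt _).sub_const _

/-- The continuous square root `√r⁺ + i √r⁻` of a real number. -/
def complexSqrt (r : ℝ) : ℂ := (√r : ℂ) + (√(-r) : ℂ) * Complex.I

lemma continuous_complexSqrt : Continuous complexSqrt := by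
  unfold complexSqrt
  fun_prop

lemma complexSqrt_sq (r : ℝ) : complexSqrt r ^ 2 = r := by
  rcases le_total 0 r with hr | hr
  · rw [complexSqrt, Real.sqrt_eq_zero_of_nonpos (x := -r) (by linarith)]
    simp [← Complex.ofReal_pow, Real.sq_sqrt hr]
  · rw [complexSqrt, Real.sqrt_eq_zero_of_nonpos hr]
    simp [mul_pow, ← Complex.ofReal_pow, Real.sq_sqrt (neg_nonneg.2 hr)]

/-- For real `c` the squared momenta are real, and `complexSqrt` is a root continuous on all of `ℝ`,
so no branch has to be chosen. -/
lemma SeparatedData.exists_complex_solution (h : SeparatedData g ρ v I a b) :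
    ∃ u : (Fin (n + 2) → ℝ) → (Fin (n + 1) → ℝ) → ℂ,
      (∀ c : Fin (n + 1) → ℝ, IsSeparatedSolution ℂ (quadFun ℂ g ρ v) (univ.pi I)
        (fun ξ => (c ξ : ℂ)) (fun x => u x c)) ∧
      (∀ i, ContinuousOn (fun z : (Fin (n + 2) → ℝ) × (Fin (n + 1) → ℝ) =>
        pd i (fun x => u x z.2) z.1) (univ.pi I ×ˢ univ)) := by
  rcases (univ.pi I).eq_empty_or_nonempty with h0 | ⟨q, hq⟩
  · rw [h0]
    exact ⟨fun _ _ => 0, fun c => ⟨contDiffOn_const, ⟨fun _ _ => 0, by simp⟩, by simp, by simp,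
      by simp⟩, by simp⟩
  · have hc : ∀ i, ContinuousOn (fun z : ℝ × (Fin (n + 1) → ℝ) =>
        complexSqrt (momentumSq a b i z.1 z.2)) (I i ×ˢ univ) := fun i =>
      continuous_complexSqrt.comp_continuousOn (h.contDiffOn_momentumSq i).continuousOn
    have key := fun c : Fin (n + 1) → ℝ => h.isSeparatedSolution (𝕜 := ℂ) (fun _ => subset_rfl)
      h.isOpen h.ordConnected hq (c := fun ξ => (c ξ : ℂ))
      (f := fun i t => complexSqrt (momentumSq a b i t c))
      (fun i => (hc i).comp (f := fun t => (t, c)) (by fun_prop) fun t ht => ⟨ht, trivial⟩)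
      (fun i t _ => by
        rw [complexSqrt_sq]
        simp [momentumSq])
    refine ⟨fun x c => ∑ j, ∫ τ in q j..x j, complexSqrt (momentumSq a b j τ c),
      fun c => (key c).2, fun i => ?_⟩
    refine ContinuousOn.congr ((hc i).comp (f := fun z : (Fin (n + 2) → ℝ) × (Fin (n + 1) → ℝ) =>
      (z.1 i, z.2)) (by fun_prop) fun z hz => ⟨hz.1 i trivial, trivial⟩) fun z hz => ?_
    exact (key z.2).1 z.1 hz.1 i

end

/-! ### Smooth families with essential parameters. -/

section

open Set

variable {n : ℕ} {U : Set (Fin (n + 2) → ℝ)} {g : Fin (n + 2) → (Fin (n + 2) → ℝ) → ℝ}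
  {ρ : Fin (n + 2) → Fin (n + 2) → (Fin (n + 2) → ℝ) → ℝ}
  {v : Fin (n + 2) → (Fin (n + 2) → ℝ) → ℝ}
  {I : Fin (n + 2) → Set ℝ} {a : Fin (n + 2) → Fin (n + 1) → ℝ → ℝ}
  {b : Fin (n + 2) → ℝ → ℝ}

/-- If the squares of the components of `y` depend on `c` through the first columns of a
nonsingular matrix, the matrix `(∂y_i / ∂c_ξ)` has independent columns. -/
lemma linearIndependent_of_sq {𝕜 : Type*} [RCLike 𝕜] {A : Matrix (Fin (n + 2)) (Fin (n + 2)) ℝ}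
    (hA : A.det ≠ 0) {y : Fin (n + 2) → 𝕜} {y' : Fin (n + 1) → Fin (n + 2) → 𝕜}
    (h : ∀ i ξ, 2 * y i * y' ξ i = algebraMap ℝ 𝕜 (A i ξ.castSucc)) :
    LinearIndependent 𝕜 y' := by
  rw [Fintype.linearIndependent_iff]
  intro d hd
  have h1 : ((algebraMap ℝ 𝕜).mapMatrix A).mulVec (Fin.snoc (α := fun _ => 𝕜) d 0) = 0 := by
    funext i
    have h2 := congrFun hd i
    simp only [Finset.sum_apply, Pi.smul_apply, smul_eq_mul, Pi.zero_apply] at h2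
    rw [Matrix.mulVec, dotProduct, Fin.sum_univ_castSucc]
    simp only [Fin.snoc_castSucc, Fin.snoc_last, mul_zero, add_zero, RingHom.mapMatrix_apply,
      Matrix.map_apply, ← h, Pi.zero_apply]
    calc ∑ ξ, 2 * y i * y' ξ i * d ξ = 2 * y i * ∑ ξ, d ξ * y' ξ i := by
          rw [Finset.mul_sum]
          exact Finset.sum_congr rfl fun ξ _ => by ring
      _ = 0 := by rw [h2, mul_zero]
  have hdet : ((algebraMap ℝ 𝕜).mapMatrix A).det ≠ 0 := by
    rw [← RingHom.map_det]
    simpa using hA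
  intro ξ
  have := congrFun (Matrix.eq_zero_of_mulVec_eq_zero hdet h1) ξ.castSucc
  simpa using this

lemma SeparatedData.exists_neighbourhood {𝕜 : Type*} [RCLike 𝕜] (h : SeparatedData g ρ v I a b)
    {x₀ : Fin (n + 2) → ℝ} (hx₀ : x₀ ∈ univ.pi I) {c₀ : Fin (n + 1) → 𝕜} {W : Fin (n + 2) → Set 𝕜}
    (hW : ∀ i, IsOpen (W i)) (hc₀ : ∀ i, momentumSq a b i (x₀ i) c₀ ∈ W i) :
    ∃ ε > 0, ∀ i, ∀ t ∈ Metric.ball (x₀ i) ε, ∀ c ∈ Metric.ball c₀ ε,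
      t ∈ I i ∧ momentumSq a b i t c ∈ W i := by
  have h1 : ∀ i, ∃ ε > 0, ∀ t ∈ Metric.ball (x₀ i) ε, ∀ c ∈ Metric.ball c₀ ε,
      t ∈ I i ∧ momentumSq a b i t c ∈ W i := by
    intro i
    have ho := (h.contDiffOn_momentumSq (𝕜 := 𝕜) i).continuousOn.isOpen_inter_preimage
      ((h.isOpen i).prod isOpen_univ) (hW i)
    obtain ⟨ε, hε, hb⟩ := Metric.isOpen_iff.1 ho (x₀ i, c₀)
      ⟨⟨hx₀ i trivial, trivial⟩, hc₀ i⟩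
    refine ⟨ε, hε, fun t ht c hc => ?_⟩
    have := hb (show (t, c) ∈ Metric.ball (x₀ i, c₀) ε by
      rw [← ball_prod_same]; exact ⟨ht, hc⟩)
    exact ⟨this.1.1, this.2⟩
  choose ε hε hb using h1
  refine ⟨Finset.univ.inf' Finset.univ_nonempty ε, by simpa using hε, fun i t ht c hc => ?_⟩
  have hle : Finset.univ.inf' Finset.univ_nonempty ε ≤ ε i := Finset.inf'_le _ (Finset.mem_univ i)
  exact hb i t (Metric.ball_subset_ball hle ht) c (Metric.ball_subset_ball hle hc)

/-- Since no component of `p₀` vanishes, smooth branches of the square root exist near the `p₀ᵢ²`;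
`c₀` is forced to be the values of the quadratic functions at `(x₀, p₀)`. -/
lemma SeparatedData.exists_family {𝕜 : Type} [RCLike 𝕜] (h : SeparatedData g ρ v I a b)
    {x₀ : Fin (n + 2) → ℝ} (hx₀ : x₀ ∈ univ.pi I) {p₀ : Fin (n + 2) → 𝕜} (hp₀ : ∀ i, p₀ i ≠ 0)
    (hL : quadFun 𝕜 g ρ v (Fin.last (n + 1)) x₀ p₀ = 0) :
    ∃ (V : Set (Fin (n + 2) → ℝ)) (Λ : Set (Fin (n + 1) → 𝕜))
      (u : (Fin (n + 2) → ℝ) → (Fin (n + 1) → 𝕜) → 𝕜) (c₀ : Fin (n + 1) → 𝕜),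
      IsOpen V ∧ x₀ ∈ V ∧ V ⊆ univ.pi I ∧ IsOpen Λ ∧ c₀ ∈ Λ ∧
      IsSeparatedFamily 𝕜 (quadFun 𝕜 g ρ v) V Λ u ∧
      ∀ i, pd i (fun x => u x c₀) x₀ = p₀ i := by
  choose W s hW hpW hs hsp hsq using fun i => exists_sqrt_branch (hp₀ i)
  let c₀ : Fin (n + 1) → 𝕜 := fun ξ => quadFun 𝕜 g ρ v ξ.castSucc x₀ p₀
  have hc₀ : ∀ i, momentumSq a b i (x₀ i) c₀ = p₀ i ^ 2 := h.momentumSq_eq hx₀ hL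
  obtain ⟨ε, hε, hb⟩ := h.exists_neighbourhood hx₀ (c₀ := c₀) hW
    fun i => by rw [hc₀]; exact hpW i
  let J : Fin (n + 2) → Set ℝ := fun i => Metric.ball (x₀ i) ε
  let Λ : Set (Fin (n + 1) → 𝕜) := Metric.ball c₀ ε
  have hJ : ∀ i, IsOpen (J i) := fun i => Metric.isOpen_ball
  have hJc : ∀ i, (J i).OrdConnected := fun i => (convex_ball _ _).ordConnected
  have hΛ : IsOpen Λ := Metric.isOpen_ball
  have hcΛ : c₀ ∈ Λ := Metric.mem_ball_self hε
  have hxJ : x₀ ∈ univ.pi J := fun i _ => Metric.mem_ball_self hε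
  have hJI : ∀ i, J i ⊆ I i := fun i t ht => (hb i t ht c₀ hcΛ).1
  have hmaps : ∀ i, MapsTo (fun z : ℝ × (Fin (n + 1) → 𝕜) => momentumSq a b i z.1 z.2)
      (J i ×ˢ Λ) (W i) := fun i z hz => (hb i z.1 hz.1 z.2 hz.2).2
  let G : Fin (n + 2) → ℝ → (Fin (n + 1) → 𝕜) → 𝕜 := fun i t c => s i (momentumSq a b i t c)
  have hmom : ∀ i, ContDiffOn ℝ ∞ (fun z : ℝ × (Fin (n + 1) → 𝕜) => momentumSq a b i z.1 z.2)
      (J i ×ˢ Λ) := fun i =>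
    (h.contDiffOn_momentumSq i).mono (prod_mono (hJI i) (subset_univ _))
  have hG : ∀ i, ContDiffOn ℝ ∞ (fun z : ℝ × (Fin (n + 1) → 𝕜) => G i z.1 z.2) (J i ×ˢ Λ) :=
    fun i => ((hs i).restrict_scalars ℝ).comp (hmom i) (hmaps i)
  have hGsq : ∀ i, ∀ t ∈ J i, ∀ c ∈ Λ, G i t c ^ 2 = momentumSq a b i t c ∧ G i t c ≠ 0 :=
    fun i t ht c hc => hsq i _ (hb i t ht c hc).2
  let G' : Fin (n + 2) → ℝ → (Fin (n + 1) → 𝕜) → ((Fin (n + 1) → 𝕜) →L[𝕜] 𝕜) := fun i t c =>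
    deriv (s i) (momentumSq a b i t c) • ∑ ξ, algebraMap ℝ 𝕜 (a i ξ t) •
      ContinuousLinearMap.proj (R := 𝕜) (φ := fun _ : Fin (n + 1) => 𝕜) ξ
  have hG' : ∀ i, ∀ t ∈ J i, ∀ c ∈ Λ, HasFDerivAt (G i t) (G' i t c) c := fun i t ht c hc =>
    HasDerivAt.comp_hasFDerivAt (h₂ := s i) c
      (((hs i).differentiableOn (by simp)).differentiableAt
        ((hW i).mem_nhds (hb i t ht c hc).2)).hasDerivAt
      (hasFDerivAt_momentumSq i t c)
  have hsol := fun c (hc : c ∈ Λ) => h.isSeparatedSolution hJI hJ hJc hxJ (c := c)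
    (f := fun i t => G i t c)
    (fun i => (hG i).continuousOn.comp (f := fun t => (t, c)) (by fun_prop) fun t ht => ⟨ht, hc⟩)
    (fun i t ht => (hGsq i t ht c hc).1)
  refine ⟨univ.pi J, Λ, fun x c => ∑ j, ∫ τ in x₀ j..x j, G j τ c, c₀,
    isOpen_set_pi finite_univ fun i _ => hJ i, hxJ, pi_mono fun i _ => hJI i, hΛ, hcΛ,
    ⟨?_, ?_, fun c hc => (hsol c hc).2, ?_⟩, fun i => ?_⟩
  · refine ContDiffOn.sum fun j _ => ?_
    exact (contDiffOn_primitive (hJ j) (hJc j) (hxJ j trivial) hΛ (hG j)).comp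
      (g := fun z : ℝ × (Fin (n + 1) → 𝕜) => ∫ τ in x₀ j..z.1, G j τ z.2)
      (f := fun z : (Fin (n + 2) → ℝ) × (Fin (n + 1) → 𝕜) => (z.1 j, z.2))
      (by fun_prop) fun z hz => ⟨hz.1 j trivial, hz.2⟩
  · intro x hx c hc
    refine (DifferentiableAt.fun_sum fun j _ => ?_).differentiableWithinAt
    have hsw : ContinuousOn (fun z : (Fin (n + 1) → 𝕜) × ℝ => (z.2, z.1)) (Λ ×ˢ J j) := by
      fun_prop
    have hsm : MapsTo (fun z : (Fin (n + 1) → 𝕜) × ℝ => (z.2, z.1)) (Λ ×ˢ J j) (J j ×ˢ Λ) :=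
      fun z hz => ⟨hz.2, hz.1⟩
    refine (hasFDerivAt_integral_of_continuousOn (𝕜 := 𝕜) (hΛ.prod (hJ j))
      (f := fun z => G j z.2 z.1) (f' := fun z => G' j z.2 z.1)
      ((hG j).continuousOn.comp hsw hsm) ?_ (fun z hz => hG' j z.2 hz.2 z.1 hz.1)
      (fun t ht => ⟨hc, (hJc j).uIcc_subset (hxJ j trivial) (hx j trivial) ht⟩)).differentiableAt
    refine ContinuousOn.smul (f := fun z : (Fin (n + 1) → 𝕜) × ℝ =>
      deriv (s j) (momentumSq a b j z.2 z.1)) ?_ (continuousOn_finsetSum _ fun ξ _ => ?_)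
    · exact ((hs j).continuousOn_deriv_of_isOpen (hW j) (by simp)).comp
        ((hmom j).continuousOn.comp hsw hsm) ((hmaps j).comp hsm)
    · refine ContinuousOn.smul (f := fun z : (Fin (n + 1) → 𝕜) × ℝ =>
        algebraMap ℝ 𝕜 (a j ξ z.2)) ?_ continuousOn_const
      exact (RCLike.continuous_ofReal (K := 𝕜)).comp_continuousOn
        (((h.smooth_inv j ξ).continuousOn.mono (hJI j)).comp continuousOn_snd fun z hz => hz.2)
  · intro x hx c hc
    have hxI : x ∈ univ.pi I := fun i _ => hJI i (hx i trivial)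
    have hdet : (coeffMatrix g ρ x)⁻¹.det ≠ 0 := by
      rw [Matrix.det_nonsing_inv]
      simpa using h.det_ne_zero x hxI
    refine linearIndependent_of_sq hdet (y := fun i => G i (x i) c) fun i ξ => ?_
    have hev : (fun e => pd i (fun y => ∑ j, ∫ τ in x₀ j..y j, G j τ e) x) =ᶠ[nhds c]
        G i (x i) := by
      filter_upwards [hΛ.mem_nhds hc] with e he using (hsol e he).1 x hx i
    have hd := hG' i (x i) (hx i trivial) c hc
    rw [hev.fderiv_eq, hd.fderiv, h.inv_eq x hxI]
    -- Differentiating `G² = momentumSq` in `c` gives `2 G ∂_ξ G = S_{iξ}` without using the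
    -- derivative of the branch.
    have hsqd : HasFDerivAt (fun e => G i (x i) e ^ 2) _ c := hd.pow 2
    have hev2 : (fun e => G i (x i) e ^ 2) =ᶠ[nhds c] momentumSq a b i (x i) := by
      filter_upwards [hΛ.mem_nhds hc] with e he using (hGsq i _ (hx i trivial) e he).1
    have := congrArg (fun T => T (Pi.single ξ 1))
      ((hsqd.congr_of_eventuallyEq hev2.symm).unique (hasFDerivAt_momentumSq i (x i) c))
    simpa [Pi.single_apply] using this
  · rw [(hsol c₀ hcΛ).1 x₀ hxJ i]
    simp only [G, hc₀, hsp]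

end

end NonregularSeparation

end

/-! ### Assembly of the theorem. -/

open NonregularSeparation in
theorem theorem1 (n : ℕ) (U : Set (Fin (n + 2) → ℝ)) (hU : IsOpen U)
    (g : Fin (n + 2) → (Fin (n + 2) → ℝ) → ℝ)
    (ρ : Fin (n + 2) → Fin (n + 2) → (Fin (n + 2) → ℝ) → ℝ)
    (v : Fin (n + 2) → (Fin (n + 2) → ℝ) → ℝ)
    (hg : ∀ i, ContDiffOn ℝ ∞ (g i) U) (hg0 : ∀ i, ∀ x ∈ U, g i x ≠ 0)
    (hρ : ∀ ℓ i, ContDiffOn ℝ ∞ (ρ ℓ i) U) (hρ1 : ∀ i, ∀ x ∈ U, ρ 0 i x = 1)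
    (hv : ∀ i, ContDiffOn ℝ ∞ (v i) U)
    (hind : ∀ x ∈ U, LinearIndependent ℝ
      (fun ℓ => NonregularSeparation.quadFun ℝ g ρ v ℓ x))
    (hconst : ∀ k, NonregularSeparation.InvolutiveModulo U
      (NonregularSeparation.quadFun ℝ g ρ v (Fin.last (n + 1)))
      (NonregularSeparation.quadFun ℝ g ρ v 0) (NonregularSeparation.quadFun ℝ g ρ v k)) :
    -- the functions `v i` and the generalized Eisenhart equations
    ((∀ x ∈ U, ∀ i j, j ≠ i → NonregularSeparation.pd j (v i) x = 0) ∧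
      (∀ x ∈ U, ∀ m, ρ (Fin.last (n + 1)) m x ≠ 0 → ∀ ℓ i α,
        NonregularSeparation.pd i (ρ ℓ α) x +
            (ρ ℓ α x - ρ ℓ i x) * (NonregularSeparation.pd i (g α) x / g α x) =
          ρ (Fin.last (n + 1)) α x / ρ (Fin.last (n + 1)) m x *
            (NonregularSeparation.pd i (ρ ℓ m) x +
              (ρ ℓ m x - ρ ℓ i x) * (NonregularSeparation.pd i (g m) x / g m x)))) ∧
    -- the generalized Stäckel matrix
    (∀ Q ⊆ U, NonregularSeparation.IsOpenBox Q →
      NonregularSeparation.IsGeneralizedStackel Q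
        (fun x => (NonregularSeparation.coeffMatrix g ρ x)⁻¹)) ∧
    -- separated solutions depending on `N - 1` parameters
    ((∀ Q ⊆ U, NonregularSeparation.IsOpenBox Q →
        ∃ u : (Fin (n + 2) → ℝ) → (Fin (n + 1) → ℝ) → ℂ,
          (∀ c : Fin (n + 1) → ℝ, NonregularSeparation.IsSeparatedSolution ℂ
            (NonregularSeparation.quadFun ℂ g ρ v) Q (fun ξ => (c ξ : ℂ)) (fun x => u x c)) ∧
          (∀ i, ContinuousOn (fun z : (Fin (n + 2) → ℝ) × (Fin (n + 1) → ℝ) =>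
            NonregularSeparation.pd i (fun x => u x z.2) z.1) (Q ×ˢ Set.univ))) ∧
      NonregularSeparation.HasSeparatedFamilies ℝ (NonregularSeparation.quadFun ℝ g ρ v) U ∧
      NonregularSeparation.HasSeparatedFamilies ℂ (NonregularSeparation.quadFun ℂ g ρ v) U) ∧
    -- involution modulo the side condition
    (∀ ℓ k, NonregularSeparation.InvolutiveModulo U
      (NonregularSeparation.quadFun ℝ g ρ v (Fin.last (n + 1)))
      (NonregularSeparation.quadFun ℝ g ρ v ℓ) (NonregularSeparation.quadFun ℝ g ρ v k)) := by
  have hT : ∀ k j, ContDiffOn ℝ ∞ (fun y => ρ k j y * g j y) U := fun k j => (hρ k j).mul (hg j)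
  have hdet : ∀ x ∈ U, (coeffMatrix g ρ x).det ≠ 0 := fun x hx =>
    det_coeffMatrix_ne_zero (hind x hx)
  have hat : ∀ {f : (Fin (n + 2) → ℝ) → ℝ}, ContDiffOn ℝ ∞ f U → ∀ x ∈ U, ContDiffAt ℝ ∞ f x :=
    fun hf x hx => hf.contDiffAt (hU.mem_nhds hx)
  have hda : ∀ {f : (Fin (n + 2) → ℝ) → ℝ}, ContDiffOn ℝ ∞ f U → ∀ x ∈ U,
      DifferentiableAt ℝ f x := fun hf x hx => (hat hf x hx).differentiableAt (by simp)
  have key := fun x (hx : x ∈ U) => exists_structureEquations_and_pd_potential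
    (fun i => hat (hg i) x hx) (fun i => hg0 i x hx) (fun ℓ i => hat (hρ ℓ i) x hx)
    (fun i => by filter_upwards [hU.mem_nhds hx] with y hy using hρ1 i y hy)
    (fun i => hat (hv i) x hx) (hdet x hx) (fun k => hconst k x hx)
  choose b hb using fun x hx => (key x hx).1
  have hv0 := fun x hx => (key x hx).2
  have hdata : ∀ I : Fin (n + 2) → Set ℝ, (∀ i, IsOpen (I i) ∧ (I i).OrdConnected) →
      Set.univ.pi I ⊆ U → ∃ a b, SeparatedData g ρ v I a b := fun I hI hIU =>
    exists_separatedData hT hdet hv (fun x hx ξ i j hj =>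
      (hb x hx).pd_inv_eq_zero hU hx hT (fun i => hg0 i x hx) hdet (Fin.castSucc_ne_last ξ) hj)
      hv0 hI hIU
  have hfam : ∀ (𝕜 : Type) [RCLike 𝕜], HasSeparatedFamilies 𝕜 (quadFun 𝕜 g ρ v) U := by
    intro 𝕜 _ x₀ hx₀ p₀ hp₀ hL
    obtain ⟨ε, hε, hball⟩ := Metric.isOpen_iff.1 hU x₀ hx₀
    -- Balls of the sup metric are boxes, so the box results apply near any point of `U`.
    rw [ball_pi x₀ hε] at hball
    obtain ⟨a, b, h⟩ := hdata _
      (fun i => ⟨Metric.isOpen_ball, (convex_ball (x₀ i) ε).ordConnected⟩) hball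
    obtain ⟨V, Λ, u, c₀, hV, hxV, hVI, hrest⟩ :=
      h.exists_family (fun i _ => Metric.mem_ball_self hε) hp₀ hL
    exact ⟨V, Λ, u, c₀, hV, hxV, hVI.trans hball, hrest⟩
  refine ⟨⟨fun x hx i j hj => hv0 x hx j i hj.symm, fun x hx m hm ℓ i α => ?_⟩, ?_,
    ⟨?_, hfam ℝ, hfam ℂ⟩, fun ℓ k x hx =>
    (hb x hx).involutive (fun i => hda (hg i) x hx) (fun ℓ i => hda (hρ ℓ i) x hx)
      (fun i => hda (hv i) x hx) (hv0 x hx) ℓ k⟩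
  · have h := (hb x hx).eisenhart (fun i => hda (hg i) x hx) (fun i => hg0 i x hx)
      (fun ℓ i => hda (hρ ℓ i) x hx) i ℓ
    rw [h α, h m]
    field_simp
  · rintro Q hQU ⟨I, hI, rfl⟩
    obtain ⟨a, b, h⟩ := hdata I hI hQU
    refine ⟨fun i j => (contDiffOn_matrix_inv (A := coeffMatrix g ρ) hT hdet i j).mono hQU,
      fun x hx => ?_, fun i ξ => ⟨a i ξ, fun x hx => h.inv_eq x hx i ξ⟩⟩
    rw [Matrix.det_nonsing_inv]
    simpa using hdet x (hQU hx)
  · rintro Q hQU ⟨I, hI, rfl⟩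
    obtain ⟨a, b, h⟩ := hdata I hI hQU
    exact h.exists_complex_solution
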